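/- Let $p>q$ be prime numbers, let $e$ be the order of $p$ modulo $q$, let $g\ge 1$ be an integer and $n=qg+1$, and assume $p^e>n$ and $p\ge n+q-2$. Let $m\ge 1$, let $\mathbb Q_p^{(m)}$ be the unramified extension of $\mathbb Q_p$ of degree $m$ (with the norm $|\cdot|_p$ extending the $p$-adic norm) and $\mathbb Z_p^{(m)}$ its ring of integers. For $z=(z_1,\dots,z_n)$ and $s\ge 1$ put $$\Phi_s(t,z)=\big((t-z_1)\cdots(t-z_n)\big)^{(p^{es}-1)/q},$$ let $A(\Phi_s)=\big(\mathrm{Coeff}_{t^{p^{es}v-u}}\Phi_s\big)_{u,v=1,\dots,g}$, and let $I_s(z)$ be the $n\times g$ matrix whose entry in row $i$ and column $\ell$ is the coefficient of $t^{\ell p^{es}-1}$ in $\Phi_s(t,z)/(t-z_i)$. Let $$\mathfrak D=\mathfrak D^{(m)}_{\rm KZ}=\{a\in(\mathbb Z_p^{(m)})^n : |\det A(\Phi_1(t,a))|_p=1\},\qquad \mathfrak D^{o}=\{a\in\mathfrak D : a_i\ne a_j \text{ for } i\neq j\}.$$ Let $W=\{I\in(\mathbb Q_p^{(m)})^n :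 I_1+\dots+I_n=0\}$, let $\Omega_{ij}$ ($i\ne j$) be the $n\times n$ matrix with entries $-1$ at $(i,i)$ and $(j,j)$, $1$ at $(i,j)$ and $(j,i)$, and $0$ elsewhere, and let $$H_i(z)=\frac1q\sum_{j\ne i}\frac{\Omega_{ij}}{z_i-z_j},\qquad \nabla_i^{\rm KZ}=\frac{\partial}{\partial z_i}-H_i(z),\qquad i=1,\dots,n.$$ "Analytic" means locally given by convergent power series over $\mathbb Q_p^{(m)}$. Then: 1. For $s\ge1$ and $a\in\mathfrak D$ one has $|\det A(\Phi_s(t,a))|_p=1$, and the matrices $I_s(a)\,A(\Phi_s(t,a))^{-1}$ converge as $s\to\infty$, uniformly on $\mathfrak D$, to an analytic $n\times g$ matrix $\mathcal I(a)$. 2. Let $\mathcal L_a$ be the span of the columns of $\mathcal I(a)$. Then $\mathcal L_a\subset W$ for $a\in\mathfrak D$, and $\dim W=qg$. 3. (Invariance over $\mathfrak D$.) Let $U\subset\mathfrak D$ be open and let $s=\mathcal I\cdot c$ on $U$ with $c=(c_1,\dots,c_g)$ analytic on $U$. Then for every $i$ there is an analytic $c'=(c_1',\dots,c_g')$ on $U$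 with $\nabla^{\rm KZ}_i s=\mathcal I\cdot c'$ on $U\cap\mathfrak D^{o}$. 4. (Invariance over $\mathfrak D^{o}$.) Let $U\subset\mathfrak D^{o}$ be open and let $s$ be analytic on $U$ with $s(z)\in\mathcal L_z$ for all $z\in U$. Then for every $i$, $\nabla_i^{\rm KZ}s$ is analytic on $U$ and $(\nabla_i^{\rm KZ}s)(z)\in\mathcal L_z$ for all $z\in U$. 5. Let $d_\Phi$ be the degree of the polynomial $\det A(\Phi_1)\in\mathbb Z[z]$ and $d_M$ the degree of the $g\times g$ minor of $I_1(z)$ in the rows $q(g-\ell)+1$, $\ell=1,\dots,g$. If $p^m>d_\Phi+d_M$, then $\dim\mathcal L_a=g$ for all $a\in\mathfrak D^{o}$. -/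

import Mathlib

open Filter Topology

noncomputable section

namespace PadicKZ

/-- The unramified extension of degree `m` of `ℚ_p` inside the algebraic closure `PadicAlgCl p`,
obtained by adjoining the roots of unity of order dividing `p ^ m - 1`. -/
def unramified (p : ℕ) [Fact p.Prime] (m : ℕ) : IntermediateField ℚ_[p] (PadicAlgCl p) :=
  IntermediateField.adjoin ℚ_[p] {ζ : PadicAlgCl p | ζ ^ (p ^ m - 1) = 1}

/-- The field `ℚ_p^{(m)}`, with the norm induced from `PadicAlgCl p`, which extends the `p`-adic
norm of `ℚ_p`. -/
def Qpm (p : ℕ) [Fact p.Prime] (m : ℕ) : Type := unramified p m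

instance (p : ℕ) [Fact p.Prime] (m : ℕ) : NontriviallyNormedField (Qpm p m) :=
  inferInstanceAs (NontriviallyNormedField (unramified p m))

section Polynomials

/-- The order `e` of `p` modulo `q`. -/
def ord (p q : ℕ) : ℕ := orderOf (p : ZMod q)

/-- The master polynomial `Φ_s(t, z) = ((t - z_1) ⋯ (t - z_n)) ^ ((p ^ (e s) - 1) / q)`,
with `n = q g + 1`, as a polynomial in `t` over `ℤ[z_1, …, z_n]`. -/
def masterPoly (p q g s : ℕ) : Polynomial (MvPolynomial (Fin (q * g + 1)) ℤ) :=
  (∏ j, (Polynomial.X - Polynomial.C (MvPolynomial.X j))) ^ ((p ^ (ord p q * s) - 1) / q)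

/-- The Hasse--Witt matrix `A(Φ_s)`: its `(u, v)` entry, `u, v = 1, …, g`, is the coefficient of
`t ^ (p ^ (e s) v - u)` in `Φ_s(t, z)`. The indices in `Fin g` start at `0`, hence the shifts. -/
def hasseWitt (p q g s : ℕ) : Matrix (Fin g) (Fin g) (MvPolynomial (Fin (q * g + 1)) ℤ) :=
  Matrix.of fun u v =>
    (masterPoly p q g s).coeff (p ^ (ord p q * s) * ((v : ℕ) + 1) - ((u : ℕ) + 1))

/-- The `n × g` matrix `I_s(z)` of `p ^ (e s)`-hypergeometric solutions: its entry in row `i` and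
column `ℓ = 1, …, g` is the coefficient of `t ^ (ℓ p ^ (e s) - 1)` in `Φ_s(t, z) / (t - z_i)`
(the division is exact for `s ≥ 1`). -/
def hypSol (p q g s : ℕ) : Matrix (Fin (q * g + 1)) (Fin g) (MvPolynomial (Fin (q * g + 1)) ℤ) :=
  Matrix.of fun i l =>
    (masterPoly p q g s /ₘ (Polynomial.X - Polynomial.C (MvPolynomial.X i))).coeff
      (((l : ℕ) + 1) * p ^ (ord p q * s) - 1)

/-- The degree `d_Φ` of the polynomial `det A(Φ_1)`. -/
def dPhi (p q g : ℕ) : ℕ := (hasseWitt p q g 1).det.totalDegree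

/-- The row with index `q (g - ℓ) + 1` (counted from `1`), for `ℓ = 1, …, g`. -/
def minorRow (q g : ℕ) (l : Fin g) : Fin (q * g + 1) :=
  ⟨q * (g - ((l : ℕ) + 1)), Nat.lt_succ_of_le (Nat.mul_le_mul_left q (Nat.sub_le _ _))⟩

/-- The degree `d_M` of the `g × g` minor `M(z)` of `I_1(z)` in the rows `q (g - ℓ) + 1`. -/
def dM (p q g : ℕ) : ℕ := ((hypSol p q g 1).submatrix (minorRow q g) id).det.totalDegree

end Polynomials

section Analysis

variable (K : Type*) [NontriviallyNormedField K]

/-- The value `A(Φ_s(t, a))` of the Hasse--Witt matrix at a point `a`. -/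
def hasseWittAt (p q g s : ℕ) (a : Fin (q * g + 1) → K) : Matrix (Fin g) (Fin g) K :=
  (hasseWitt p q g s).map (MvPolynomial.aeval a)

/-- The value `I_s(a)` of the matrix of `p ^ (e s)`-hypergeometric solutions at a point `a`. -/
def hypSolAt (p q g s : ℕ) (a : Fin (q * g + 1) → K) : Matrix (Fin (q * g + 1)) (Fin g) K :=
  (hypSol p q g s).map (MvPolynomial.aeval a)

/-- The matrices `I_s(a) A(Φ_s(t, a))⁻¹` whose limit is `𝓘(a)`. -/
def approxFrame (p q g s : ℕ) (a : Fin (q * g + 1) → K) : Matrix (Fin (q * g + 1)) (Fin g) K :=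
  hypSolAt K p q g s a * (hasseWittAt K p q g s a)⁻¹

/-- The matrix `𝓘(a) = lim_{s → ∞} I_s(a) A(Φ_s(t, a))⁻¹`. -/
def frame (p q g : ℕ) (a : Fin (q * g + 1) → K) : Matrix (Fin (q * g + 1)) (Fin g) K :=
  Matrix.of fun i l => limUnder atTop fun s : ℕ => approxFrame K p q g s a i l

/-- The domain `𝔇_KZ`: the integral points `a` with `|det A(Φ_1(t, a))| = 1`. -/
def domainKZ (p q g : ℕ) : Set (Fin (q * g + 1) → K) :=
  {a | (∀ i, ‖a i‖ ≤ 1) ∧ ‖(hasseWittAt K p q g 1 a).det‖ = 1}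

/-- The domain `𝔇_KZ^o`: the points of `𝔇_KZ` with pairwise distinct coordinates. -/
def domainKZo (p q g : ℕ) : Set (Fin (q * g + 1) → K) :=
  {a | a ∈ domainKZ K p q g ∧ ∀ i j, i ≠ j → a i ≠ a j}

/-- The fiber `W = {I : I_1 + ⋯ + I_n = 0}` of the KZ bundle. -/
def fiberW (n : ℕ) : Submodule K (Fin n → K) where
  carrier := {I | ∑ i, I i = 0}
  add_mem' := by
    intro a b ha hb
    simp only [Set.mem_ofPred_eq, Pi.add_apply, Finset.sum_add_distrib] at *
    rw [ha, hb, add_zero]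
  zero_mem' := by simp
  smul_mem' := by
    intro c a ha
    simp only [Set.mem_ofPred_eq, Pi.smul_apply, ← Finset.smul_sum] at *
    rw [ha, smul_zero]

/-- The fiber `𝓛_a`, spanned by the columns of `𝓘(a)`. -/
def fiberL (p q g : ℕ) (a : Fin (q * g + 1) → K) : Submodule K (Fin (q * g + 1) → K) :=
  Submodule.span K (Set.range fun l : Fin g => fun i => frame K p q g a i l)

/-- The matrix `Ω_{ij}` (for `i ≠ j`): `-1` at `(i, i)` and `(j, j)`, `1` at `(i, j)` and `(j, i)`,
and zero elsewhere. -/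
def Omega {n : ℕ} (i j : Fin n) : Matrix (Fin n) (Fin n) K :=
  Matrix.single i j 1 + Matrix.single j i 1 - Matrix.single i i 1 - Matrix.single j j 1

variable {K}

/-- The Gaudin Hamiltonian `H_i(z) = (1 / q) ∑_{j ≠ i} Ω_{ij} / (z_i - z_j)`
(meaningful where the coordinates of `z` are pairwise distinct). -/
def gaudin (q : ℕ) {n : ℕ} (i : Fin n) (z : Fin n → K) : Matrix (Fin n) (Fin n) K :=
  (q : K)⁻¹ • ∑ j ∈ Finset.univ.erase i, (z i - z j)⁻¹ • Omega K i j

/-- The KZ connection `∇_i^KZ s = ∂s/∂z_i - H_i s`. -/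
def nablaKZ (q : ℕ) {n : ℕ} (i : Fin n) (s : (Fin n → K) → (Fin n → K)) (z : Fin n → K) :
    Fin n → K :=
  fderiv K s z (Pi.single i 1) - (gaudin q i z).mulVec (s z)

/-- Sections over `U` that are combinations `∑_l c_l(z) 𝓘_l(z)` of the columns of `𝓘` with
coefficients analytic on `U`. -/
def IsFrameSection (p q g : ℕ) (U : Set (Fin (q * g + 1) → K))
    (s : (Fin (q * g + 1) → K) → (Fin (q * g + 1) → K)) : Prop :=
  ∃ c : (Fin (q * g + 1) → K) → (Fin g → K), AnalyticOnNhd K c U ∧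
    ∀ z ∈ U, s z = (frame K p q g z).mulVec (c z)

/-- Analytic maps on `U` whose value at every `z ∈ U` lies in `𝓛_z`. -/
def IsFiberSection (p q g : ℕ) (U : Set (Fin (q * g + 1) → K))
    (s : (Fin (q * g + 1) → K) → (Fin (q * g + 1) → K)) : Prop :=
  AnalyticOnNhd K s U ∧ ∀ z ∈ U, s z ∈ fiberL K p q g z

end Analysis

end PadicKZ

end

/-! Write F = ∏ (t - z_j), P = p^e and N_s = (P^s - 1)/q. A polynomial k gives the row vector of the
coefficients of t^(l P^s - 1), l = 1, …, g, in k F^(N_s - 1). Taking k = t^u F gives the rows of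
A(Φ_s), and k = F/(t - z_i) gives the rows of I_s. Multiplying by A(Φ_s)⁻¹ gives the normalized rows
`nrow`, and everything is proved for these with general k.

Convergence. The powers (F^(N_d))^(P^i) are sums of terms p^j H_j(t^(P^(i-j))). Hence the
coefficient functionals of level s factor modulo p^i through the normalized rows of level i
(`factors_coeff`), which yields nrow_s ≡ nrow_i mod p^i (`dvd_nrow_sub_nrow`). This is algebra over
any commutative ring in which the determinants of all A(Φ_s), s ≥ 1, are units. In a local ring
where p is not a unit, the first determinant suffices, by a Frobenius factorization in
characteristic p (`det_hwMatrix_succ`). Over the ring of integers the congruences give uniform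
convergence. Over power series in X at the point a + X they give convergence of all Taylor
coefficients, hence analyticity of the limit and convergence of the first derivatives
(`analyticAt_limRow_and_tendsto_fderiv`).

Invariance. Differentiating nrow · A = row gives a formula for ∂_i nrow at each finite level. Since
N_s → -1/q in K, the limit is ∂_i 𝓘 = H_i 𝓘 - q⁻¹ 𝓘 B_i off the diagonals (`fderiv_limFrame`), where
B_i is `connMatrix`, analytic on all of 𝔇. So ∇_i (𝓘 c) = 𝓘 (∂_i c - q⁻¹ B_i c).

Rank. At a point with distinct coordinates every polynomial is a combination of the F/(t - a_i)
modulo the expressions -q⁻¹ F' r + F r' (`exists_reduction`). Multiplied by F^(N_s - 1), such an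
expression is a t-derivative up to a multiple of P^s, so its relevant coefficients are O(P^s). For
t^u F this reads A(Φ_s) = C I_s + O(P^s), hence C 𝓘 = 1 (`exists_mul_limFrame_eq_one`). This left
inverse gives the rank, and also the analytic coefficients needed for fiberwise sections. -/

noncomputable section

namespace PadicKZ

/-! ### Dwork congruences for normalized coefficient rows -/

section Congruences

open Polynomial

variable {R : Type*} [CommRing R]

/-- The exponent `(P ^ s - 1) / q`. -/
def expo (P q s : ℕ) : ℕ := (P ^ s - 1) / q

theorem mul_expo {P q : ℕ} (h : q ∣ P - 1) (s : ℕ) : q * expo P q s = P ^ s - 1 :=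
  Nat.mul_div_cancel' (h.trans (by simpa using Nat.sub_dvd_pow_sub_pow P 1 s))

theorem expo_add {P q : ℕ} (hq : 0 < q) (hP : 1 < P) (h : q ∣ P - 1) (i j : ℕ) :
    expo P q (i + j) = expo P q i + P ^ i * expo P q j := by
  apply Nat.eq_of_mul_eq_mul_left hq
  have h1 : 0 < P ^ i := by positivity
  have h2 : 0 < P ^ j := by positivity
  have h3 : P ^ i ≤ P ^ i * P ^ j := Nat.le_mul_of_pos_right _ h2
  rw [mul_add, mul_left_comm, mul_expo h, mul_expo h, mul_expo h, pow_add, Nat.mul_sub]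
  omega

theorem expo_pos {P q : ℕ} (hP : 1 < P) (h : q ∣ P - 1) {s : ℕ} (hs : 1 ≤ s) :
    0 < expo P q s := by
  have h1 := mul_expo h s
  have h2 : 1 < P ^ s := Nat.one_lt_pow (by omega) hP
  rcases Nat.eq_zero_or_pos (expo P q s) with h0 | h0
  · rw [h0] at h1; omega
  · exact h0

/-- Taking away an exponent m N from W N - 1 leaves an exponent of the same shape, the one used in
`row`. The terms with m ≥ W drop out because m N exceeds W N - 1. -/
theorem coeff_mul_expand (Y H : R[X]) {N W : ℕ} (hN : 0 < N) (hW : 0 < W) :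
    (Y * expand R N H).coeff (W * N - 1) =
      ∑ m ∈ Finset.range W, Y.coeff ((W - m) * N - 1) * H.coeff m := by
  induction H using Polynomial.induction_on' with
  | add a b ha hb => simp only [map_add, mul_add, coeff_add, ha, hb, Finset.sum_add_distrib]
  | monomial k c =>
    rw [expand_monomial, ← C_mul_X_pow_eq_monomial, ← mul_assoc, coeff_mul_X_pow', coeff_mul_C]
    simp only [coeff_monomial]
    by_cases hk : k < W
    · have h1 : k * N + N ≤ W * N := by rw [← Nat.succ_mul]; exact Nat.mul_le_mul_right _ hk
      rw [if_pos (by omega), Finset.sum_eq_single k (fun m _ hm => by rw [if_neg hm.symm, mul_zero])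
        (fun h => absurd (Finset.mem_range.2 hk) h), if_pos rfl, Nat.sub_mul]
      congr 2; omega
    · rw [if_neg, Finset.sum_eq_zero]
      · intro m hm
        rw [if_neg (by have := Finset.mem_range.1 hm; omega), mul_zero]
      · have : W * N ≤ k * N := Nat.mul_le_mul_right _ (not_lt.1 hk)
        have := Nat.mul_pos hW hN
        omega

/-- The row vector of the coefficients of `t ^ (l P ^ s - 1)`, `l = 1, …, g`, in
`k F ^ (expo P q s - 1)`. -/
def row (F : R[X]) (P q g s : ℕ) (k : R[X]) : Fin g → R :=
  fun l => (k * F ^ (expo P q s - 1)).coeff (((l : ℕ) + 1) * P ^ s - 1)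

/-- The Hasse--Witt matrix of `F ^ (expo P q s)`. -/
def hwMatrix (F : R[X]) (P q g s : ℕ) : Matrix (Fin g) (Fin g) R :=
  Matrix.of fun u => row F P q g s (X ^ (u : ℕ) * F)

/-- The row `row F P q g s k` normalized by the inverse of the Hasse--Witt matrix. -/
def nrow (F : R[X]) (P q g s : ℕ) (k : R[X]) : Fin g → R :=
  Matrix.vecMul (row F P q g s k) (hwMatrix F P q g s)⁻¹

/-- All powers `E ^ (P ^ r)` have a decomposition into pieces `p ^ j H_j (t ^ (P ^ (r - j)))`. -/
def HasGhost (p P : ℕ) (E : R[X]) : Prop :=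
  ∀ r, ∃ H : ℕ → R[X], E ^ P ^ r =
    ∑ j ∈ Finset.range (r + 1), C ((p : R) ^ j) * expand R (P ^ (r - j)) (H j)

theorem HasGhost.map {S : Type*} [CommRing S] (φ : R →+* S) {p P : ℕ} {E : R[X]}
    (h : HasGhost p P E) : HasGhost p P (E.map φ) := by
  intro r
  obtain ⟨H, hH⟩ := h r
  refine ⟨fun j => (H j).map φ, ?_⟩
  rw [← Polynomial.map_pow, hH, Polynomial.map_sum]
  simp [map_expand]

theorem nrow_vecMul {F : R[X]} {P q g s : ℕ} (h : IsUnit (hwMatrix F P q g s).det) (k : R[X]) :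
    Matrix.vecMul (nrow F P q g s k) (hwMatrix F P q g s) = row F P q g s k := by
  rw [nrow, Matrix.vecMul_vecMul, Matrix.nonsing_inv_mul _ h, Matrix.vecMul_one]

theorem sum_nrow_mul {F : R[X]} {P q g s : ℕ} (h : IsUnit (hwMatrix F P q g s).det) (k : R[X])
    (l : Fin g) :
    ∑ u, nrow F P q g s k u * row F P q g s (X ^ (u : ℕ) * F) l = row F P q g s k l :=
  congrFun (nrow_vecMul h k) l

/-- With N = (P^i - 1)/q the degree is at most g P^i + N - 1, and N < P^i. So only the g positions
recorded in `row` can carry a nonzero coefficient. -/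
theorem coeff_eq_zero_of_large {F k : R[X]} {P q g i w : ℕ} (hq : 0 < q) (hP : 1 < P)
    (h : q ∣ P - 1) (hF : F.natDegree ≤ q * g + 1) (hk : k.natDegree ≤ q * g + g)
    (hi : 1 ≤ i) (hw : g < w) : (k * F ^ (expo P q i - 1)).coeff (w * P ^ i - 1) = 0 := by
  apply coeff_eq_zero_of_natDegree_lt
  obtain ⟨N, hN⟩ : ∃ N, expo P q i = N + 1 := ⟨_, (Nat.sub_add_cancel (expo_pos hP h hi)).symm⟩
  have h1 := mul_expo h i
  have h2 : 1 < P ^ i := Nat.one_lt_pow (by omega) hP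
  have h3 : k.natDegree + N * F.natDegree ≤ q * g + g + N * (q * g + 1) := by gcongr
  have h4 : (g + 1) * P ^ i ≤ w * P ^ i := Nat.mul_le_mul_right _ hw
  rw [hN] at h1
  refine (natDegree_mul_le.trans (Nat.add_le_add_left natDegree_pow_le _)).trans_lt ?_
  rw [hN, Nat.add_sub_cancel]
  refine h3.trans_lt ?_
  obtain ⟨Q, hQ⟩ : ∃ Q, P ^ i = Q + 1 := ⟨_, (Nat.sub_add_cancel h2.le).symm⟩
  rw [hQ] at h1 h4 h2 ⊢
  have h5 : N + 1 ≤ Q := by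
    rw [Nat.add_sub_cancel] at h1; rw [← h1]; exact Nat.le_mul_of_pos_left _ hq
  have h6 : g * Q = g * (q * (N + 1)) := by rw [h1, Nat.add_sub_cancel]
  have h7 : (g + 1) * (Q + 1) = g * Q + g + Q + 1 := by ring
  have h8 : g * (q * (N + 1)) = q * g * N + q * g := by ring
  have h9 : N * (q * g + 1) = q * g * N + N := by ring
  omega

/-- Modulo `p ^ i`, the functional `θ` factors through the normalized rows of level `i`. -/
def Factors (p : ℕ) (F : R[X]) (P q g i : ℕ) (θ : R[X] → R) : Prop :=
  ∀ k : R[X], k.natDegree ≤ q * g + g →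
    (p : R) ^ i ∣ θ k - ∑ u : Fin g, nrow F P q g i k u * θ (X ^ (u : ℕ) * F)

theorem Factors.sum {ι : Type*} (S : Finset ι) {p : ℕ} {F : R[X]} {P q g i : ℕ}
    {θ : ι → R[X] → R} (h : ∀ x ∈ S, Factors p F P q g i (θ x)) :
    Factors p F P q g i fun k => ∑ x ∈ S, θ x k := by
  intro k hk
  have : ∑ x ∈ S, θ x k - ∑ u : Fin g, nrow F P q g i k u * ∑ x ∈ S, θ x (X ^ (u : ℕ) * F) =
      ∑ x ∈ S, (θ x k - ∑ u : Fin g, nrow F P q g i k u * θ x (X ^ (u : ℕ) * F)) := by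
    rw [Finset.sum_sub_distrib, Finset.sum_comm (s := S)]
    simp only [Finset.mul_sum]
  rw [this]
  exact Finset.dvd_sum fun x hx => h x hx k hk

theorem Factors.mul_const {p : ℕ} {F : R[X]} {P q g i : ℕ} {θ : R[X] → R}
    (h : Factors p F P q g i θ) (c : R) : Factors p F P q g i fun k => θ k * c := by
  intro k hk
  have : θ k * c - ∑ u : Fin g, nrow F P q g i k u * (θ (X ^ (u : ℕ) * F) * c) =
      (θ k - ∑ u : Fin g, nrow F P q g i k u * θ (X ^ (u : ℕ) * F)) * c := by
    rw [sub_mul, Finset.sum_mul]; simp only [mul_assoc]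
  rw [this]
  exact Dvd.dvd.mul_right (h k hk) c

variable {p P q g : ℕ} {F : R[X]}

/-- The hypothesis says that row_s(k) ≡ nrow_i(k) A_s modulo p^i; multiply on the right by A_s⁻¹. -/
theorem dvd_nrow_sub_nrow_of_factors (hdet : ∀ s, 1 ≤ s → IsUnit (hwMatrix F P q g s).det) {i s : ℕ}
    (hs : 1 ≤ s)
    (h : ∀ l : Fin g, Factors p F P q g i fun k => row F P q g s k l) {k : R[X]}
    (hk : k.natDegree ≤ q * g + g) (u : Fin g) :
    (p : R) ^ i ∣ nrow F P q g s k u - nrow F P q g i k u := by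
  have h1 : ∀ l, (p : R) ^ i ∣ (row F P q g s k -
      Matrix.vecMul (nrow F P q g i k) (hwMatrix F P q g s)) l := fun l => h l k hk
  have h2 : nrow F P q g s k - nrow F P q g i k = Matrix.vecMul (row F P q g s k -
      Matrix.vecMul (nrow F P q g i k) (hwMatrix F P q g s)) (hwMatrix F P q g s)⁻¹ := by
    rw [Matrix.sub_vecMul, Matrix.vecMul_vecMul, Matrix.mul_nonsing_inv _ (hdet s hs),
      Matrix.vecMul_one]; rfl
  rw [← Pi.sub_apply, h2]
  simp only [Matrix.vecMul, dotProduct] at h1 ⊢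
  exact Finset.dvd_sum fun l _ => Dvd.dvd.mul_right (h1 l) _

/-- With s = i + d one has F^(N_s - 1) = F^(N_i - 1) (F^(N_d))^(P^i). Inserting the ghost
decomposition of the last factor expresses the functional through p^j times coefficients of k F^(N_i
- 1) at exponents w' P^(i-j) - 1, and each such term is treated separately. -/
theorem factors_coeff (hq : 0 < q) (hP : 1 < P) (h : q ∣ P - 1)
    (hF : F.natDegree ≤ q * g + 1) (hgh : ∀ s, HasGhost p P (F ^ expo P q s))
    (hdet : ∀ s, 1 ≤ s → IsUnit (hwMatrix F P q g s).det) (i : ℕ) :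
    ∀ s w, i ≤ s → 1 ≤ w →
      Factors p F P q g i fun k => (k * F ^ (expo P q s - 1)).coeff (w * P ^ i - 1) := by
  induction i using Nat.strong_induction_on with
  | _ i ih =>
  intro s w his hw
  rcases Nat.eq_zero_or_pos i with rfl | hi
  · intro k _; simp
  obtain ⟨d, rfl⟩ := Nat.exists_eq_add_of_le his
  obtain ⟨H, hH⟩ := hgh d i
  have hexp : expo P q (i + d) - 1 = expo P q i - 1 + expo P q d * P ^ i := by
    rw [expo_add hq hP h, mul_comm]; have := expo_pos hP h hi; omega
  have key : ∀ k : R[X], (k * F ^ (expo P q (i + d) - 1)).coeff (w * P ^ i - 1) =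
      ∑ j ∈ Finset.range (i + 1), ∑ m ∈ Finset.range (w * P ^ j),
        ((k * F ^ (expo P q i - 1)).coeff ((w * P ^ j - m) * P ^ (i - j) - 1) * (p : R) ^ j)
          * (H j).coeff m := by
    intro k
    rw [hexp, pow_add, pow_mul, hH, ← mul_assoc, Finset.mul_sum, finsetSum_coeff]
    refine Finset.sum_congr rfl fun j hj => ?_
    rw [mul_left_comm, coeff_C_mul]
    have : w * P ^ i = w * P ^ j * P ^ (i - j) := by
      rw [mul_assoc, ← pow_add, Nat.add_sub_cancel' (Nat.lt_succ_iff.1 (Finset.mem_range.1 hj))]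
    rw [this, coeff_mul_expand _ _ (pow_pos (by omega) _) (Nat.mul_pos hw (pow_pos (by omega) _)), Finset.mul_sum]
    exact Finset.sum_congr rfl fun m _ => by ring
  simp only [key]
  refine Factors.sum _ fun j hj => Factors.sum _ fun m hm => Factors.mul_const ?_ _
  have hj' : j ≤ i := Nat.lt_succ_iff.1 (Finset.mem_range.1 hj)
  have hm' : 1 ≤ w * P ^ j - m := by have := Finset.mem_range.1 hm; omega
  generalize w * P ^ j - m = w' at hm'
  rcases Nat.eq_zero_or_pos j with rfl | hj0
  -- For j = 0 the functional is an entry of the row of level i, where the factorization is exact,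
  -- or it vanishes by degree.
  · apply Factors.mul_const
    rw [Nat.sub_zero]
    intro k hk
    by_cases hw' : w' ≤ g
    · have := sum_nrow_mul (hdet i hi) k ⟨w' - 1, by omega⟩
      simp only [row, Nat.sub_add_cancel hm'] at this
      rw [this, sub_self]; exact dvd_zero _
    · have hz : ∀ k : R[X], k.natDegree ≤ q * g + g →
          (k * F ^ (expo P q i - 1)).coeff (w' * P ^ i - 1) = 0 := fun k hk =>
        coeff_eq_zero_of_large hq hP h hF hk hi (not_le.1 hw')
      beta_reduce
      rw [hz k hk, Finset.sum_eq_zero, sub_zero]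
      · exact dvd_zero _
      · intro u _
        rw [hz, mul_zero]
        refine natDegree_mul_le.trans ?_
        have := natDegree_X_pow_le (R := R) (u : ℕ)
        have := u.2
        omega
  -- For j = i the factor p^j suffices. For 0 < j < i the induction hypothesis at level i - j gives
  -- both the factorization of the functional and nrow_i ≡ nrow_(i-j), each modulo p^(i-j); the
  -- factor p^j supplies the missing precision.
  · rcases Nat.eq_zero_or_pos (i - j) with hij | hij
    · have : j = i := by omega
      subst this
      intro k _
      exact dvd_sub (Dvd.intro_left _ rfl)
        (Finset.dvd_sum fun u _ => Dvd.dvd.mul_left (Dvd.intro_left _ rfl) _)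
    · intro k hk
      have hlt : i - j < i := by omega
      have h1 := ih (i - j) hlt i w' (by omega) hm' k hk
      have h2 : ∀ u, (p : R) ^ (i - j) ∣ nrow F P q g i k u - nrow F P q g (i - j) k u := by
        refine dvd_nrow_sub_nrow_of_factors hdet hi (fun l => ?_) hk
        have := ih (i - j) hlt i ((l + 1) * P ^ j) (by omega)
          (Nat.mul_pos (Nat.succ_pos _) (pow_pos (by omega) _))
        rw [mul_assoc, ← pow_add, Nat.add_sub_cancel' hj'] at this
        exact this
      generalize hθ : (fun k : R[X] => (k * F ^ (expo P q i - 1)).coeff (w' * P ^ (i - j) - 1)) = θ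
        at h1
      have hθ' : ∀ k : R[X], (k * F ^ (expo P q i - 1)).coeff (w' * P ^ (i - j) - 1) = θ k :=
        fun k => congrFun hθ k
      simp only [hθ'] at h1 ⊢
      have h3 : θ k * (p : R) ^ j -
          ∑ u : Fin g, nrow F P q g i k u * (θ (X ^ (u : ℕ) * F) * (p : R) ^ j) =
          ((θ k - ∑ u : Fin g, nrow F P q g (i - j) k u * θ (X ^ (u : ℕ) * F)) -
          ∑ u : Fin g, (nrow F P q g i k u - nrow F P q g (i - j) k u) * θ (X ^ (u : ℕ) * F)) *
            (p : R) ^ j := by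
        simp only [sub_mul, Finset.sum_sub_distrib, Finset.sum_mul]
        simp only [← mul_assoc]; ring
      rw [h3]
      have h4 : (p : R) ^ i = (p : R) ^ (i - j) * (p : R) ^ j := by
        rw [← pow_add, Nat.sub_add_cancel hj']
      rw [h4]
      exact mul_dvd_mul_right (dvd_sub h1 (Finset.dvd_sum fun u _ => Dvd.dvd.mul_right (h2 u) _)) _

/-- The Dwork congruences: the normalized rows converge `p`-adically. -/
theorem dvd_nrow_sub_nrow (hq : 0 < q) (hP : 1 < P) (h : q ∣ P - 1)
    (hF : F.natDegree ≤ q * g + 1) (hgh : ∀ s, HasGhost p P (F ^ expo P q s))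
    (hdet : ∀ s, 1 ≤ s → IsUnit (hwMatrix F P q g s).det) {i s : ℕ} (hi : 1 ≤ i) (his : i ≤ s)
    {k : R[X]} (hk : k.natDegree ≤ q * g + g) (u : Fin g) :
    (p : R) ^ i ∣ nrow F P q g s k u - nrow F P q g i k u := by
  refine dvd_nrow_sub_nrow_of_factors hdet (hi.trans his) (fun l => ?_) hk u
  have := factors_coeff hq hP h hF hgh hdet i s ((l + 1) * P ^ (s - i)) his
    (Nat.mul_pos (Nat.succ_pos _) (pow_pos (by omega) _))
  rw [mul_assoc, ← pow_add, Nat.sub_add_cancel his] at this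
  exact this

end Congruences

/-! ### Ghost decompositions from a Frobenius lift -/

section Ghosts

open Polynomial

variable {σ : Type*}

/-- The Frobenius lift on `ℤ[z][t]` which raises all the variables to the power `P`. -/
def frobLift (σ : Type*) (P : ℕ) : (MvPolynomial σ ℤ)[X] →+* (MvPolynomial σ ℤ)[X] :=
  (expand (MvPolynomial σ ℤ) P).toRingHom.comp
    (mapRingHom (MvPolynomial.expand (R := ℤ) (σ := σ) P).toRingHom)

theorem frobLift_apply (P : ℕ) (f : (MvPolynomial σ ℤ)[X]) :
    frobLift σ P f =
      expand (MvPolynomial σ ℤ) P (f.map (MvPolynomial.expand (R := ℤ) (σ := σ) P).toRingHom) :=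
  rfl

theorem charP_of_cast_eq_zero {Q : Type*} [CommRing Q] [Nontrivial Q] {p : ℕ} [Fact p.Prime]
    (h : (p : Q) = 0) : CharP Q p := by
  obtain ⟨r, hr⟩ := CharP.exists Q
  rcases (Nat.dvd_prime (Fact.out : p.Prime)).1 ((CharP.cast_eq_zero_iff Q r p).1 h) with h2 | h2
  · subst h2
    exact (CharP.false_of_nontrivial_of_char_one (R := Q)).elim
  · rwa [h2] at hr

/-- When Q is nontrivial it has characteristic p, so both sides are ring homomorphisms in f, and
they agree on integers and on the variables. -/
theorem map_frobLift {Q : Type*} [CommRing Q] {p : ℕ} [Fact p.Prime] (h : (p : Q) = 0)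
    (π : (MvPolynomial σ ℤ)[X] →+* Q) (e : ℕ) (f : (MvPolynomial σ ℤ)[X]) :
    π (frobLift σ (p ^ e) f) = π f ^ p ^ e := by
  rcases subsingleton_or_nontrivial Q with hQ | hQ
  · exact Subsingleton.elim _ _
  have := charP_of_cast_eq_zero h
  have h : (iterateFrobenius Q p e).comp π = π.comp (frobLift σ (p ^ e)) := by
    apply Polynomial.ringHom_ext'
    · apply MvPolynomial.ringHom_ext
      · intro n; simp
      · intro i
        simp [iterateFrobenius_def, frobLift_apply]
    · simp [iterateFrobenius_def, frobLift_apply]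
  rw [← iterateFrobenius_def (R := Q) p]
  exact (congrArg (fun φ : _ →+* Q => φ f) h).symm

theorem dvd_pow_sub_frobLift (p e : ℕ) [Fact p.Prime] (f : (MvPolynomial σ ℤ)[X]) :
    (p : (MvPolynomial σ ℤ)[X]) ∣ f ^ p ^ e - frobLift σ (p ^ e) f := by
  set I : Ideal (MvPolynomial σ ℤ)[X] := Ideal.span {(p : (MvPolynomial σ ℤ)[X])} with hI
  have hp0 : (p : (MvPolynomial σ ℤ)[X] ⧸ I) = 0 := by
    rw [← map_natCast (Ideal.Quotient.mk I)]
    exact Ideal.Quotient.eq_zero_iff_mem.2 (Ideal.mem_span_singleton_self _)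
  rw [← Ideal.mem_span_singleton, ← hI, ← Ideal.Quotient.eq_zero_iff_mem, map_sub, map_pow]
  exact sub_eq_zero.2 (map_frobLift (Q := (MvPolynomial σ ℤ)[X] ⧸ I) hp0
    (Ideal.Quotient.mk I) e f).symm

/-- Let σ be the Frobenius lift. Induction on r: f^(P^(r+1)) differs from σ(f^(P^r)) by a multiple
of p^(r+1), and σ turns p^j H_j(t^(P^(r-j))) into a term of the same kind with r + 1 in place of r.
The difference is the new last term. -/
theorem hasGhost_of_mvPolynomial {p e : ℕ} [Fact p.Prime] (he : 1 ≤ e)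
    (f : (MvPolynomial σ ℤ)[X]) : HasGhost p (p ^ e) f := by
  intro r
  induction r with
  | zero => exact ⟨fun _ => f, by simp⟩
  | succ r ih =>
    obtain ⟨H, hH⟩ := ih
    -- Raising a congruence modulo p to the power p^(e r) makes it one modulo p^(e r + 1), and e r +
    -- 1 ≥ r + 1.
    have h1 := dvd_sub_pow_of_dvd_sub (dvd_pow_sub_frobLift p e f) (e * r)
    have h2 : (p : (MvPolynomial σ ℤ)[X]) ^ (r + 1) ∣
        (f ^ p ^ e) ^ p ^ (e * r) - frobLift σ (p ^ e) f ^ p ^ (e * r) :=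
      (pow_dvd_pow _ (Nat.succ_le_succ (Nat.le_mul_of_pos_left r he))).trans h1
    obtain ⟨G, hG⟩ := h2
    let τ := (MvPolynomial.expand (R := ℤ) (σ := σ) (p ^ e)).toRingHom
    refine ⟨fun j => if j ≤ r then (H j).map τ else G, ?_⟩
    beta_reduce
    rw [Finset.sum_range_succ, if_neg (Nat.not_succ_le_self r), Nat.sub_self, pow_zero, expand_one,
      Finset.sum_congr rfl (fun j hj => by
        rw [if_pos (Nat.lt_succ_iff.1 (Finset.mem_range.1 hj))])]
    have h3 : ∑ j ∈ Finset.range (r + 1), C (((p : ℕ) : MvPolynomial σ ℤ) ^ j) *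
        expand (MvPolynomial σ ℤ) ((p ^ e) ^ (r + 1 - j)) ((H j).map τ) =
        frobLift σ (p ^ e) (f ^ (p ^ e) ^ r) := by
      rw [hH, map_sum]
      refine Finset.sum_congr rfl fun j hj => ?_
      have hj' : j ≤ r := Nat.lt_succ_iff.1 (Finset.mem_range.1 hj)
      rw [map_mul, frobLift_apply, frobLift_apply, map_expand, expand_expand, ← pow_succ',
        Nat.sub_add_comm hj']
      simp [τ]
    have h4 : C (((p : ℕ) : MvPolynomial σ ℤ) ^ (r + 1)) = (p : (MvPolynomial σ ℤ)[X]) ^ (r + 1) := by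
      simp
    rw [h3, h4, ← hG, pow_succ', pow_mul, pow_mul p e r, map_pow]
    ring

end Ghosts

/-! ### Base change, and units among the Hasse–Witt determinants -/

section Specialization

open Polynomial

variable {R : Type*} [CommRing R] {n : ℕ}

/-- The polynomial `(t - z_1) ⋯ (t - z_n)`. -/
def rootPoly (z : Fin n → R) : R[X] := ∏ j, (X - C (z j))

/-- The polynomial `(t - z_1) ⋯ (t - z_n) / (t - z_i)`. -/
def cofactorPoly (z : Fin n → R) (i : Fin n) : R[X] := ∏ j ∈ Finset.univ.erase i, (X - C (z j))

theorem mul_cofactorPoly (z : Fin n → R) (i : Fin n) :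
    (X - C (z i)) * cofactorPoly z i = rootPoly z :=
  Finset.mul_prod_erase Finset.univ (fun j => X - C (z j)) (Finset.mem_univ i)

theorem map_rootPoly {S : Type*} [CommRing S] (φ : R →+* S) (z : Fin n → R) :
    (rootPoly z).map φ = rootPoly fun j => φ (z j) := by
  simp [rootPoly, Polynomial.map_prod]

theorem map_cofactorPoly {S : Type*} [CommRing S] (φ : R →+* S) (z : Fin n → R) (i : Fin n) :
    (cofactorPoly z i).map φ = cofactorPoly (fun j => φ (z j)) i := by
  simp [cofactorPoly, Polynomial.map_prod]

theorem natDegree_rootPoly_le (z : Fin n → R) : (rootPoly z).natDegree ≤ n := by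
  refine (natDegree_prod_le _ _).trans ?_
  refine (Finset.sum_le_sum fun j _ => natDegree_X_sub_C_le (z j)).trans ?_
  simp

theorem natDegree_cofactorPoly_le (z : Fin n → R) (i : Fin n) :
    (cofactorPoly z i).natDegree ≤ n - 1 := by
  refine (natDegree_prod_le _ _).trans ?_
  refine (Finset.sum_le_sum fun j _ => natDegree_X_sub_C_le (z j)).trans ?_
  simp [Finset.card_erase_of_mem]

theorem row_map {S : Type*} [CommRing S] (φ : R →+* S) (F k : R[X]) (P q g s : ℕ) (l : Fin g) :
    row (F.map φ) P q g s (k.map φ) l = φ (row F P q g s k l) := by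
  simp only [row]
  rw [← Polynomial.map_pow, ← Polynomial.map_mul, coeff_map]

theorem hwMatrix_map {S : Type*} [CommRing S] (φ : R →+* S) (F : R[X]) (P q g s : ℕ) :
    hwMatrix (F.map φ) P q g s = (hwMatrix F P q g s).map φ := by
  ext u l
  have := row_map φ F (X ^ (u : ℕ) * F) P q g s l
  rw [Polynomial.map_mul, Polynomial.map_pow, map_X] at this
  exact this

/-- Specialization of the generic polynomial over ℤ[z], so no Frobenius lift on R itself is
required. -/
theorem hasGhost_rootPoly {p e : ℕ} [Fact p.Prime] (he : 1 ≤ e) (z : Fin n → R) (N : ℕ) :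
    HasGhost p (p ^ e) (rootPoly z ^ N) := by
  have h := (hasGhost_of_mvPolynomial (p := p) he (rootPoly (n := n)
    (MvPolynomial.X (R := ℤ)) ^ N)).map (MvPolynomial.aeval z : _ →ₐ[ℤ] R).toRingHom
  rw [Polynomial.map_pow, map_rootPoly] at h
  simpa using h

theorem masterPoly_eq {p q g s : ℕ} :
    masterPoly p q g s = rootPoly MvPolynomial.X ^ expo (p ^ ord p q) q s := by
  rw [masterPoly, rootPoly, expo, pow_mul]

theorem hypSol_apply {p q g s : ℕ} (hs : 0 < expo (p ^ ord p q) q s) (i : Fin (q * g + 1))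
    (l : Fin g) : hypSol p q g s i l =
      row (rootPoly MvPolynomial.X) (p ^ ord p q) q g s (cofactorPoly MvPolynomial.X i) l := by
  obtain ⟨N, hN⟩ : ∃ N, expo (p ^ ord p q) q s = N + 1 := ⟨_, (Nat.sub_add_cancel hs).symm⟩
  rw [hypSol, Matrix.of_apply, masterPoly_eq, row, hN, Nat.add_sub_cancel, pow_mul, pow_succ',
    ← mul_cofactorPoly MvPolynomial.X i, mul_assoc,
    mul_divByMonic_cancel_left _ (monic_X_sub_C _)]

theorem hasseWitt_eq {p q g s : ℕ} (hs : 0 < expo (p ^ ord p q) q s)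
    (hg : g < (p ^ ord p q) ^ s) : hasseWitt p q g s =
      hwMatrix (rootPoly MvPolynomial.X) (p ^ ord p q) q g s := by
  obtain ⟨N, hN⟩ : ∃ N, expo (p ^ ord p q) q s = N + 1 := ⟨_, (Nat.sub_add_cancel hs).symm⟩
  ext1 u v
  rw [hasseWitt, Matrix.of_apply, masterPoly_eq, hwMatrix, Matrix.of_apply, row, hN,
    Nat.add_sub_cancel, mul_assoc, ← pow_succ', pow_mul, coeff_X_pow_mul', mul_comm ((v : ℕ) + 1)]
  have h1 : (p ^ ord p q) ^ s * 1 ≤ (p ^ ord p q) ^ s * ((v : ℕ) + 1) :=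
    Nat.mul_le_mul_left _ (by omega)
  have h2 := u.2
  -- The bound g < P^s keeps P^s (v + 1) - (u + 1) a genuine subtraction.
  rw [if_pos (by omega)]
  congr 1
  omega

/-- The numerical assumptions on the parameters. -/
structure Admissible (p e q g : ℕ) : Prop where
  q_pos : 0 < q
  e_pos : 1 ≤ e
  dvd : q ∣ p ^ e - 1
  le : g < p ^ e

theorem Admissible.one_lt {p e q g : ℕ} [Fact p.Prime] (h : Admissible p e q g) : 1 < p ^ e :=
  Nat.one_lt_pow (by have := h.e_pos; omega) (Fact.out : p.Prime).one_lt

/-- In characteristic `p` the Hasse--Witt matrices are multiplicative up to Frobenius twists. -/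
theorem det_hwMatrix_succ {p e q g : ℕ} [Fact p.Prime] [CharP R p]
    (ha : Admissible p e q g) {F : R[X]} (hF : F.natDegree ≤ q * g + 1) {s : ℕ}
    (hs : 1 ≤ s) :
    (hwMatrix F (p ^ e) q g (s + 1)).det =
      (hwMatrix F (p ^ e) q g s).det * (hwMatrix F (p ^ e) q g 1).det ^ (p ^ (e * s)) := by
  have hP : 1 < p ^ e := ha.one_lt
  obtain ⟨hq, -, h, hgP⟩ := ha
  have hmul : hwMatrix F (p ^ e) q g (s + 1) =
      hwMatrix F (p ^ e) q g s * (hwMatrix F (p ^ e) q g 1).map (iterateFrobenius R p (e * s)) := by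
    ext u l
    have hexp : expo (p ^ e) q (s + 1) - 1 =
        expo (p ^ e) q s - 1 + expo (p ^ e) q 1 * (p ^ e) ^ s := by
      rw [expo_add hq hP h, mul_comm]; have := expo_pos hP h hs; omega
    -- In characteristic p this power is a polynomial in t^(P^s) with Frobenius-twisted
    -- coefficients.
    have hE : (F ^ expo (p ^ e) q 1) ^ (p ^ e) ^ s =
        expand R ((p ^ e) ^ s) ((F ^ expo (p ^ e) q 1).map (iterateFrobenius R p (e * s))) := by
      rw [← map_expand, ← pow_mul p, map_iterateFrobenius_expand]
    have hl : ((l : ℕ) + 1) * (p ^ e) ^ (s + 1) = (((l : ℕ) + 1) * p ^ e) * (p ^ e) ^ s := by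
      ring
    have hdeg : (X ^ (u : ℕ) * F).natDegree ≤ q * g + g := by
      refine natDegree_mul_le.trans ?_
      have := natDegree_X_pow_le (R := R) (u : ℕ)
      have := u.2
      omega
    -- As g < P, the convolution runs over all g columns of A_s; its remaining terms vanish by
    -- degree.
    have hW : g ≤ ((l : ℕ) + 1) * p ^ e :=
      hgP.le.trans (Nat.le_mul_of_pos_left _ (Nat.succ_pos _))
    rw [Matrix.mul_apply]
    simp only [hwMatrix, Matrix.of_apply, Matrix.map_apply]
    rw [row, hexp, pow_add, pow_mul, hE, ← mul_assoc, hl, coeff_mul_expand _ _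
      (pow_pos (by omega) _) (Nat.mul_pos (show 0 < (l : ℕ) + 1 by omega) (by omega)),
      ← Finset.sum_range_reflect, ← Finset.sum_range_add_sum_Ico _ hW, Finset.sum_range,
      Finset.sum_eq_zero (s := Finset.Ico _ _), add_zero]
    · refine Finset.sum_congr rfl fun w _ => ?_
      have hw := w.2
      congr 1
      · rw [row]
        congr 3
        omega
      · rw [row, coeff_map, mul_assoc, ← pow_succ', Nat.sub_add_cancel (expo_pos hP h le_rfl),
          coeff_X_pow_mul', if_pos (by rw [pow_one]; omega), pow_one]
    · intro m hm
      obtain ⟨h1, h2⟩ := Finset.mem_Ico.1 hm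
      rw [coeff_eq_zero_of_large hq hP h hF hdeg hs (by omega), zero_mul]
  rw [hmul, Matrix.det_mul, ← RingHom.mapMatrix_apply, ← RingHom.map_det, iterateFrobenius_def]

/-- Over the residue field, of characteristic p, each determinant is a power of the first one by
`det_hwMatrix_succ`. -/
theorem isUnit_det_hwMatrix [IsLocalRing R] {p e q g : ℕ} [Fact p.Prime]
    (ha : Admissible p e q g) (hp : ¬ IsUnit (p : R)) {F : R[X]} (hF : F.natDegree ≤ q * g + 1)
    (h1 : IsUnit (hwMatrix F (p ^ e) q g 1).det) {s : ℕ} (hs : 1 ≤ s) :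
    IsUnit (hwMatrix F (p ^ e) q g s).det := by
  have : CharP (IsLocalRing.ResidueField R) p := by
    apply charP_of_cast_eq_zero
    rw [← map_natCast (IsLocalRing.residue R), IsLocalRing.residue_eq_zero_iff]
    exact hp
  have key : ∀ s, IsLocalRing.residue R (hwMatrix F (p ^ e) q g s).det =
      (hwMatrix (F.map (IsLocalRing.residue R)) (p ^ e) q g s).det := fun s => by
    rw [hwMatrix_map, RingHom.map_det]; rfl
  rw [← IsLocalRing.residue_ne_zero_iff_isUnit, key] at h1 ⊢
  induction s, hs using Nat.le_induction with
  | base => exact h1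
  | succ s hs ih =>
    rw [det_hwMatrix_succ ha (natDegree_map_le.trans hF) hs]
    exact mul_ne_zero ih (pow_ne_zero _ h1)

/-- A normalized row is the unique solution of x A = row, and φ carries this system to the one over
S. -/
theorem nrow_map {S : Type*} [CommRing S] (φ : R →+* S) {F : R[X]} {P q g s : ℕ}
    (h : IsUnit (hwMatrix F P q g s).det) (k : R[X]) (u : Fin g) :
    nrow (F.map φ) P q g s (k.map φ) u = φ (nrow F P q g s k u) := by
  have h1 : IsUnit (hwMatrix (F.map φ) P q g s).det := by
    rw [hwMatrix_map, ← RingHom.mapMatrix_apply, ← RingHom.map_det]; exact h.map φ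
  have h2 : Matrix.vecMul (fun u => φ (nrow F P q g s k u)) (hwMatrix (F.map φ) P q g s) =
      row (F.map φ) P q g s (k.map φ) := by
    ext l
    rw [row_map, ← sum_nrow_mul h, map_sum]
    simp only [map_mul, Matrix.vecMul, dotProduct]
    refine Finset.sum_congr rfl fun u _ => ?_
    rw [← row_map, Polynomial.map_mul, Polynomial.map_pow, map_X]
    rfl
  rw [nrow, ← h2, Matrix.vecMul_vecMul, Matrix.mul_nonsing_inv _ h1, Matrix.vecMul_one]

/-- The evaluation of integral polynomials at a point. -/
def spec (z : Fin n → R) : MvPolynomial (Fin n) ℤ →+* R := (MvPolynomial.aeval z).toRingHom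

theorem spec_apply (z : Fin n → R) (f : MvPolynomial (Fin n) ℤ) :
    spec z f = MvPolynomial.aeval z f := rfl

@[simp]
theorem spec_X (z : Fin n → R) (i : Fin n) : spec z (MvPolynomial.X i) = z i := by
  simp [spec_apply]

theorem comp_spec {S : Type*} [CommRing S] (φ : R →+* S) (z : Fin n → R) :
    φ.comp (spec z) = spec fun i => φ (z i) := by
  apply MvPolynomial.ringHom_ext
  · intro m; simp
  · intro i; simp

theorem map_spec_rootPoly (z : Fin n → R) :
    (rootPoly MvPolynomial.X).map (spec z) = rootPoly z := by
  rw [map_rootPoly]; simp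

theorem map_spec_cofactorPoly (z : Fin n → R) (i : Fin n) :
    (cofactorPoly MvPolynomial.X i).map (spec z) = cofactorPoly z i := by
  rw [map_cofactorPoly]; simp

theorem map_map_spec {S : Type*} [CommRing S] (φ : R →+* S) (z : Fin n → R)
    (k : (MvPolynomial (Fin n) ℤ)[X]) : (k.map (spec z)).map φ = k.map (spec fun i => φ (z i)) := by
  rw [Polynomial.map_map, comp_spec]

/-- The value at `z` of the normalized row attached to a polynomial `k` over `ℤ[z]`. -/
def nrowAt (P q g s : ℕ) (k : (MvPolynomial (Fin n) ℤ)[X]) (z : Fin n → R) : Fin g → R :=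
  nrow (rootPoly z) P q g s (k.map (spec z))

theorem nrowAt_map {S : Type*} [CommRing S] (φ : R →+* S) {P q g s : ℕ} {z : Fin n → R}
    (h : IsUnit (hwMatrix (rootPoly z) P q g s).det) (k : (MvPolynomial (Fin n) ℤ)[X])
    (u : Fin g) : nrowAt P q g s k (fun i => φ (z i)) u = φ (nrowAt P q g s k z u) := by
  rw [nrowAt, nrowAt, ← nrow_map φ h, map_rootPoly, map_map_spec]

/-- The generality of a local ring serves two uses: the integers of K, and power series over them.
-/
theorem dvd_nrowAt_sub_nrowAt [IsLocalRing R] {p e q g : ℕ} [Fact p.Prime]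
    (ha : Admissible p e q g) (hp : ¬ IsUnit (p : R)) {z : Fin (q * g + 1) → R}
    (h1 : IsUnit (hwMatrix (rootPoly z) (p ^ e) q g 1).det) {i s : ℕ} (hi : 1 ≤ i) (his : i ≤ s)
    {k : (MvPolynomial (Fin (q * g + 1)) ℤ)[X]} (hk : k.natDegree ≤ q * g + g) (u : Fin g) :
    (p : R) ^ i ∣ nrowAt (p ^ e) q g s k z u - nrowAt (p ^ e) q g i k z u :=
  dvd_nrow_sub_nrow ha.q_pos ha.one_lt ha.dvd (natDegree_rootPoly_le z)
    (fun _ => hasGhost_rootPoly ha.e_pos z _)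
    (fun _ hs => isUnit_det_hwMatrix ha hp (natDegree_rootPoly_le z) h1 hs) hi his
    (natDegree_map_le.trans hk) u

end Specialization

/-! ### Evaluation of bounded power series through resolvents of shifts -/

section PowerSeries

open BoundedContinuousFunction

variable (K : Type*) [NontriviallyNormedField K] {n : ℕ}

/-- Bounded families of coefficients of power series in `n` variables. -/
def CoeffSpace (n : ℕ) : Type _ := (Fin n → ℕ) →ᵇ K

instance : NormedAddCommGroup (CoeffSpace K n) :=
  inferInstanceAs (NormedAddCommGroup ((Fin n → ℕ) →ᵇ K))

instance : NormedSpace K (CoeffSpace K n) :=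
  inferInstanceAs (NormedSpace K ((Fin n → ℕ) →ᵇ K))

instance [CompleteSpace K] : CompleteSpace (CoeffSpace K n) :=
  inferInstanceAs (CompleteSpace ((Fin n → ℕ) →ᵇ K))

instance : FunLike (CoeffSpace K n) (Fin n → ℕ) K :=
  inferInstanceAs (FunLike ((Fin n → ℕ) →ᵇ K) (Fin n → ℕ) K)

namespace CoeffSpace

variable {K}

/-- The family of coefficients given by a function bounded by `C`. -/
def mk (f : (Fin n → ℕ) → K) (C : ℝ) (h : ∀ α, ‖f α‖ ≤ C) : CoeffSpace K n :=
  ofNormedAddCommGroup f continuous_of_discreteTopology C h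

@[simp]
theorem mk_apply (f : (Fin n → ℕ) → K) (C : ℝ) (h : ∀ α, ‖f α‖ ≤ C) (α : Fin n → ℕ) :
    mk f C h α = f α := rfl

@[ext]
theorem ext {c d : CoeffSpace K n} (h : ∀ α, c α = d α) : c = d := DFunLike.ext _ _ h

@[simp] theorem add_apply (c d : CoeffSpace K n) (α : Fin n → ℕ) : (c + d) α = c α + d α := rfl

@[simp] theorem sub_apply (c d : CoeffSpace K n) (α : Fin n → ℕ) : (c - d) α = c α - d α := rfl

@[simp] theorem zero_apply (α : Fin n → ℕ) : (0 : CoeffSpace K n) α = 0 := rfl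

@[simp]
theorem smul_apply (r : K) (c : CoeffSpace K n) (α : Fin n → ℕ) : (r • c) α = r * c α := rfl

theorem norm_apply_le (c : CoeffSpace K n) (α : Fin n → ℕ) : ‖c α‖ ≤ ‖c‖ :=
  BoundedContinuousFunction.norm_coe_le_norm (f := (c : (Fin n → ℕ) →ᵇ K)) α

theorem norm_le {c : CoeffSpace K n} {C : ℝ} (hC : 0 ≤ C) (h : ∀ α, ‖c α‖ ≤ C) : ‖c‖ ≤ C :=
  (BoundedContinuousFunction.norm_le (f := (c : (Fin n → ℕ) →ᵇ K)) hC).2 h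

end CoeffSpace

/-- The operator `c ↦ (α ↦ c (α + e_i))` on families of coefficients. -/
def lowerShift (i : Fin n) : CoeffSpace K n →L[K] CoeffSpace K n :=
  LinearMap.mkContinuous
    { toFun := fun c => CoeffSpace.mk (fun α => c (α + Pi.single i 1)) ‖c‖
        fun _ => c.norm_apply_le _
      map_add' := fun c d => by ext α; simp
      map_smul' := fun r c => by ext α; simp } 1
    (fun c => by
      rw [one_mul]
      exact CoeffSpace.norm_le (norm_nonneg _) fun _ => c.norm_apply_le _)

@[simp]
theorem lowerShift_apply (i : Fin n) (c : CoeffSpace K n) (α : Fin n → ℕ) :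
    lowerShift K i c α = c (α + Pi.single i 1) := rfl

/-- The operator on families of coefficients that corresponds to the multiplication by the `i`-th
variable. -/
def raiseShift (i : Fin n) : CoeffSpace K n →L[K] CoeffSpace K n :=
  LinearMap.mkContinuous
    { toFun := fun c => CoeffSpace.mk
        (fun α => if α i = 0 then 0 else c (α - Pi.single i 1)) ‖c‖ (fun α => by
          split_ifs
          · simp
          · exact c.norm_apply_le _)
      map_add' := fun c d => by
        ext α
        simp only [CoeffSpace.mk_apply, CoeffSpace.add_apply]
        split_ifs <;> simp
      map_smul' := fun r c => by
        ext α
        simp only [CoeffSpace.mk_apply, CoeffSpace.smul_apply, RingHom.id_apply]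
        split_ifs <;> simp } 1
    (fun c => by
      rw [one_mul]
      refine CoeffSpace.norm_le (norm_nonneg _) fun α => ?_
      simp only [LinearMap.coe_mk, AddHom.coe_mk, CoeffSpace.mk_apply]
      split_ifs
      · simp
      · exact c.norm_apply_le _)

/-- The constant coefficient. -/
def constCoeff : CoeffSpace K n →L[K] K :=
  LinearMap.mkContinuous
    { toFun := fun c => c 0
      map_add' := fun _ _ => rfl
      map_smul' := fun _ _ => rfl } 1
    (fun c => by rw [one_mul]; exact c.norm_apply_le 0)

theorem raiseShift_apply (i : Fin n) (c : CoeffSpace K n) (α : Fin n → ℕ) :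
    raiseShift K i c α = if α i = 0 then 0 else c (α - Pi.single i 1) := rfl

theorem lowerShift_mul_raiseShift (i : Fin n) : lowerShift K i * raiseShift K i = 1 := by
  ext c α
  simp [raiseShift_apply]

theorem commute_lowerShift_raiseShift {i j : Fin n} (h : i ≠ j) :
    Commute (lowerShift K j) (raiseShift K i) := by
  ext c α
  simp only [mul_apply_eq_comp, lowerShift_apply, raiseShift_apply, Pi.add_apply,
    Pi.single_eq_of_ne h, add_zero]
  split_ifs with h0
  · rfl
  · congr 1
    ext k
    simp only [Pi.add_apply, Pi.sub_apply, Pi.single_apply]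
    split_ifs with h1 h2 h2
    · exact absurd (h2.symm.trans h1) h
    · simp
    · subst h2; omega
    · simp

theorem commute_lowerShift (i j : Fin n) : Commute (lowerShift K j) (lowerShift K i) := by
  ext c α
  simp only [mul_apply_eq_comp, lowerShift_apply]
  rw [add_right_comm]

/-- The resolvent `(1 - x T_i)⁻¹` of the shift `T_i`. -/
def shiftInv (i : Fin n) (x : K) : CoeffSpace K n →L[K] CoeffSpace K n :=
  Ring.inverse (1 - x • lowerShift K i)

/-- The functional `c ↦ ∑_α c_α y^α`. -/
def evalFun (y : Fin n → K) : CoeffSpace K n →L[K] K :=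
  (constCoeff K).comp ((List.finRange n).map fun i => shiftInv K i (y i)).prod

variable {K}

section

variable [CompleteSpace K]

theorem isUnit_one_sub_smul_lowerShift (i : Fin n) {x : K} (hx : ‖x‖ < 1) :
    IsUnit (1 - x • lowerShift K i) := by
  apply isUnit_one_sub_of_norm_lt_one
  refine (norm_smul_le _ _).trans_lt (lt_of_le_of_lt ?_ hx)
  exact mul_le_of_le_one_right (norm_nonneg _) (LinearMap.mkContinuous_norm_le _ zero_le_one _)

theorem shiftInv_eq (i : Fin n) {x : K} (hx : ‖x‖ < 1) :
    ∃ u : (CoeffSpace K n →L[K] CoeffSpace K n)ˣ,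
      (u : CoeffSpace K n →L[K] CoeffSpace K n) = 1 - x • lowerShift K i ∧
        shiftInv K i x = ↑u⁻¹ := by
  obtain ⟨u, hu⟩ := isUnit_one_sub_smul_lowerShift i hx
  exact ⟨u, hu, by rw [shiftInv, ← hu, Ring.inverse_unit]⟩

theorem commute_shiftInv_raiseShift {i j : Fin n} (h : i ≠ j) {x : K} (hx : ‖x‖ < 1) :
    Commute (shiftInv K j x) (raiseShift K i) := by
  obtain ⟨u, hu, hu'⟩ := shiftInv_eq j hx
  rw [hu']
  apply Commute.units_inv_left
  rw [hu]
  exact (Commute.one_left _).sub_left ((commute_lowerShift_raiseShift K h).smul_left x)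

theorem commute_shiftInv {i j : Fin n} {x y : K} (hx : ‖x‖ < 1) (hy : ‖y‖ < 1) :
    Commute (shiftInv K j x) (shiftInv K i y) := by
  obtain ⟨u, hu, hu'⟩ := shiftInv_eq j hx
  obtain ⟨v, hv, hv'⟩ := shiftInv_eq i hy
  rw [hu', hv']
  apply Commute.units_inv_left
  apply Commute.units_inv_right
  rw [hu, hv]
  exact (Commute.one_left _).sub_left
    ((Commute.one_right _).sub_right (((commute_lowerShift K i j).smul_left x).smul_right y))

/-- With T lowering and S raising, T S = 1 gives (1 - x T) S = S - x. -/
theorem shiftInv_mul_raiseShift_sub (i : Fin n) {x : K} (hx : ‖x‖ < 1) :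
    shiftInv K i x * (raiseShift K i - x • 1) = raiseShift K i := by
  obtain ⟨u, hu, hu'⟩ := shiftInv_eq i hx
  rw [hu', Units.inv_mul_eq_iff_eq_mul, hu, sub_mul, one_mul, smul_mul_assoc,
    lowerShift_mul_raiseShift]

/-- The resolvents with index other than i commute with S_i - y_i, and all of them commute with each
other. The i-th one turns S_i - y_i into S_i, whose image has zero constant coefficient. -/
theorem prod_shiftInv_raiseShift {y : Fin n → K} (hy : ∀ i, ‖y i‖ < 1) (i : Fin n)
    (l : List (Fin n)) (hl : l.Nodup) (hi : i ∈ l) (c : CoeffSpace K n) :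
    ((l.map fun i => shiftInv K i (y i)).prod * (raiseShift K i - y i • 1)) c 0 = 0 := by
  induction l generalizing c with
  | nil => simp at hi
  | cons j l ih =>
    rw [List.map_cons, List.prod_cons]
    rw [List.nodup_cons] at hl
    by_cases hij : i = j
    · subst hij
      have h1 : Commute (l.map fun i => shiftInv K i (y i)).prod (raiseShift K i - y i • 1) := by
        apply Commute.list_prod_left
        intro x hx
        obtain ⟨k, hk, rfl⟩ := List.mem_map.1 hx
        refine (commute_shiftInv_raiseShift ?_ (hy k)).sub_right
          ((Commute.one_right _).smul_right _)
        rintro rfl; exact hl.1 hk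
      rw [mul_assoc, h1.eq, ← mul_assoc, shiftInv_mul_raiseShift_sub i (hy i)]
      simp [raiseShift_apply]
    · have h1 : Commute (shiftInv K j (y j)) (l.map fun i => shiftInv K i (y i)).prod := by
        apply Commute.list_prod_right
        intro x hx
        obtain ⟨k, hk, rfl⟩ := List.mem_map.1 hx
        exact commute_shiftInv (hy j) (hy k)
      have h2 : Commute (shiftInv K j (y j)) (raiseShift K i - y i • 1) :=
        (commute_shiftInv_raiseShift hij (hy j)).sub_right ((Commute.one_right _).smul_right _)
      rw [mul_assoc, (h1.mul_right h2).eq]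
      exact ih hl.2 ((List.mem_cons.1 hi).resolve_left hij) _

theorem evalFun_raiseShift {y : Fin n → K} (hy : ∀ i, ‖y i‖ < 1) (i : Fin n)
    (c : CoeffSpace K n) : evalFun K y (raiseShift K i c) = y i * evalFun K y c := by
  have h := prod_shiftInv_raiseShift hy i _ (List.nodup_finRange n) (List.mem_finRange i) c
  rw [mul_sub, mul_smul_comm, mul_one, _root_.sub_apply, _root_.smul_apply, CoeffSpace.sub_apply,
    CoeffSpace.smul_apply] at h
  exact sub_eq_zero.1 h

theorem evalFun_of_lowerShift_eq_zero {y : Fin n → K} (hy : ∀ i, ‖y i‖ < 1)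
    {c : CoeffSpace K n} (hc : ∀ i, lowerShift K i c = 0) : evalFun K y c = c 0 := by
  have h : ∀ l : List (Fin n), (l.map fun i => shiftInv K i (y i)).prod c = c := by
    intro l
    induction l with
    | nil => rfl
    | cons j l ih =>
      rw [List.map_cons, List.prod_cons, mul_apply_eq_comp, ih]
      obtain ⟨u, hu, hu'⟩ := shiftInv_eq j (hy j)
      have h1 : (u : CoeffSpace K n →L[K] CoeffSpace K n) c = c := by simp [hu, hc]
      have h2 : ((↑u⁻¹ : CoeffSpace K n →L[K] CoeffSpace K n) *
        (u : CoeffSpace K n →L[K] CoeffSpace K n)) c = c := by rw [Units.inv_mul]; rfl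
      rw [hu']
      rwa [mul_apply_eq_comp, h1] at h2
  rw [evalFun, ContinuousLinearMap.comp_apply, h]
  rfl

/-- Inversion in the Banach algebra of operators is analytic, so no rearrangement of multivariable
series is needed. -/
theorem analyticAt_evalFun : AnalyticAt K (fun y : Fin n → K => evalFun K y) 0 := by
  have h1 : ∀ i : Fin n, AnalyticAt K (fun y : Fin n → K => shiftInv K i (y i)) 0 := by
    intro i
    have hu : (1 : CoeffSpace K n →L[K] CoeffSpace K n) - (0 : Fin n → K) i • lowerShift K i =
      ((1 : (CoeffSpace K n →L[K] CoeffSpace K n)ˣ) : CoeffSpace K n →L[K] CoeffSpace K n) := by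
      simp
    have h2 := analyticAt_inverse (𝕜 := K) (1 : (CoeffSpace K n →L[K] CoeffSpace K n)ˣ)
    rw [← hu] at h2
    refine h2.comp (g := Ring.inverse)
      (f := fun y : Fin n → K => (1 : CoeffSpace K n →L[K] CoeffSpace K n) - y i • lowerShift K i)
      ?_
    exact analyticAt_const.sub
      (((ContinuousLinearMap.proj (R := K) (φ := fun _ : Fin n => K) i).analyticAt _).smul
        analyticAt_const)
  have h2 : ∀ l : List (Fin n),
      AnalyticAt K (fun y : Fin n → K => (l.map fun i => shiftInv K i (y i)).prod) 0 := by
    intro l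
    induction l with
    | nil => exact analyticAt_const
    | cons j l ih =>
      simp only [List.map_cons, List.prod_cons]
      exact (h1 j).mul ih
  exact ((ContinuousLinearMap.compL K (CoeffSpace K n) (CoeffSpace K n) K
    (constCoeff K)).analyticAt _).comp (h2 _)

end

end PowerSeries

/-! ### Power series over the ring of integers -/

section Integers

variable (K : Type*) [NontriviallyNormedField K] [IsUltrametricDist K]

/-- The subring of the elements of norm at most one. -/
def integers : Subring K where
  carrier := {x | ‖x‖ ≤ 1}
  mul_mem' := fun {a b} ha hb => by
    simp only [Set.mem_ofPred_eq] at *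
    rw [norm_mul]; exact mul_le_one₀ ha (norm_nonneg _) hb
  one_mem' := by simp
  add_mem' := fun {a b} ha hb => by
    simp only [Set.mem_ofPred_eq] at *
    exact (IsUltrametricDist.norm_add_le_max a b).trans (max_le ha hb)
  zero_mem' := by simp
  neg_mem' := fun {a} ha => by simpa using ha

variable {K}

theorem norm_integers_le (x : integers K) : ‖(x : K)‖ ≤ 1 := x.2

theorem isUnit_integers_iff {x : integers K} : IsUnit x ↔ ‖(x : K)‖ = 1 := by
  constructor
  · rintro ⟨u, rfl⟩
    refine le_antisymm (norm_integers_le _) ?_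
    have h : ‖((u : integers K) : K)‖ * ‖((↑u⁻¹ : integers K) : K)‖ = 1 := by
      rw [← norm_mul, ← Subring.coe_mul, Units.mul_inv]; simp
    rw [← h]
    exact mul_le_of_le_one_right (norm_nonneg _) (norm_integers_le _)
  · intro h
    have h0 : (x : K) ≠ 0 := norm_ne_zero_iff.1 (by rw [h]; exact one_ne_zero)
    exact IsUnit.of_mul_eq_one ⟨(x : K)⁻¹, show ‖_‖ ≤ 1 by rw [norm_inv, h, inv_one]⟩
      (Subtype.ext (mul_inv_cancel₀ h0))

/-- The family of the coefficients of a power series with integral coefficients. -/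
def coeffFamily {n : ℕ} (φ : MvPowerSeries (Fin n) (integers K)) : CoeffSpace K n :=
  CoeffSpace.mk
    (fun α => ((MvPowerSeries.coeff (Finsupp.equivFunOnFinite.symm α) φ : integers K) : K))
    1 fun _ => norm_integers_le _

variable {n : ℕ}

theorem coeffFamily_apply (φ : MvPowerSeries (Fin n) (integers K)) (α : Fin n → ℕ) :
    coeffFamily φ α = (MvPowerSeries.coeff (Finsupp.equivFunOnFinite.symm α) φ : integers K) := rfl

theorem coeffFamily_add (φ ψ : MvPowerSeries (Fin n) (integers K)) :
    coeffFamily (φ + ψ) = coeffFamily φ + coeffFamily ψ := by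
  ext α; simp [coeffFamily_apply]

theorem coeffFamily_sub (φ ψ : MvPowerSeries (Fin n) (integers K)) :
    coeffFamily (φ - ψ) = coeffFamily φ - coeffFamily ψ := by
  ext α; simp [coeffFamily_apply]

theorem coeffFamily_mul_C (φ : MvPowerSeries (Fin n) (integers K)) (x : integers K) :
    coeffFamily (φ * MvPowerSeries.C x) = (x : K) • coeffFamily φ := by
  ext α; simp [coeffFamily_apply, mul_comm]

theorem coeffFamily_mul_X (φ : MvPowerSeries (Fin n) (integers K)) (i : Fin n) :
    coeffFamily (φ * MvPowerSeries.X i) = raiseShift K i (coeffFamily φ) := by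
  ext α
  rw [coeffFamily_apply, raiseShift_apply, MvPowerSeries.X, MvPowerSeries.coeff_mul_monomial]
  by_cases h : α i = 0
  · rw [if_neg, if_pos h]; · rfl
    intro h'
    have := h' i
    simp [h] at this
  · rw [if_pos, if_neg h, mul_one, coeffFamily_apply]
    · congr 3
      ext j
      simp [Finsupp.single_apply, Pi.single_apply, eq_comm]
    · intro j
      by_cases hj : i = j
      · subst hj; simpa [Nat.one_le_iff_ne_zero] using h
      · simp [hj]

/-- Turns a p-adic congruence of power series into an estimate in the Banach space of coefficients.
-/
theorem norm_coeffFamily_sub_le {p i : ℕ} {φ ψ : MvPowerSeries (Fin n) (integers K)}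
    (h : (p : MvPowerSeries (Fin n) (integers K)) ^ i ∣ φ - ψ) :
    ‖coeffFamily φ - coeffFamily ψ‖ ≤ ‖(p : K)‖ ^ i := by
  obtain ⟨χ, hχ⟩ := h
  have h1 : (p : MvPowerSeries (Fin n) (integers K)) ^ i =
      MvPowerSeries.C ((p : integers K) ^ i) := by simp
  rw [← coeffFamily_sub, hχ, h1, mul_comm, coeffFamily_mul_C, norm_smul]
  have h2 : ‖coeffFamily χ‖ ≤ 1 :=
    CoeffSpace.norm_le zero_le_one fun _ => norm_integers_le _
  have h3 : (((p : integers K) ^ i : integers K) : K) = (p : K) ^ i := by simp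
  rw [h3, norm_pow]
  exact mul_le_of_le_one_right (by positivity) h2

variable [CompleteSpace K]

/-- A polynomial second factor is enough: normalized rows only get multiplied by polynomial
matrices. -/
theorem evalFun_coeffFamily_mul {y : Fin n → K} (hy : ∀ i, ‖y i‖ < 1)
    (φ : MvPowerSeries (Fin n) (integers K)) (P : MvPolynomial (Fin n) (integers K)) :
    evalFun K y (coeffFamily (φ * (P : MvPowerSeries (Fin n) (integers K)))) =
      evalFun K y (coeffFamily φ) * MvPolynomial.eval₂ (integers K).subtype y P := by
  induction P using MvPolynomial.induction_on generalizing φ with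
  | C a =>
    rw [MvPolynomial.coe_C, coeffFamily_mul_C, map_smul, MvPolynomial.eval₂_C, smul_eq_mul,
      mul_comm]; rfl
  | add P Q hP hQ =>
    rw [MvPolynomial.coe_add, mul_add, coeffFamily_add, map_add, hP, hQ, MvPolynomial.eval₂_add,
      mul_add]
  | mul_X P i hP =>
    rw [MvPolynomial.coe_mul, MvPolynomial.coe_X, ← mul_assoc, coeffFamily_mul_X,
      evalFun_raiseShift hy, hP, MvPolynomial.eval₂_mul, MvPolynomial.eval₂_X]
    ring

theorem evalFun_coeffFamily_one {y : Fin n → K} (hy : ∀ i, ‖y i‖ < 1) :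
    evalFun K y (coeffFamily 1) = 1 := by
  rw [evalFun_of_lowerShift_eq_zero hy]
  · rw [coeffFamily_apply, MvPowerSeries.coeff_one, if_pos (by ext; rfl)]
    rfl
  · intro i
    ext α
    rw [lowerShift_apply, coeffFamily_apply, MvPowerSeries.coeff_one, if_neg]
    · rfl
    · intro h
      have := DFunLike.congr_fun h i
      simp at this

theorem evalFun_coeffFamily_coe {y : Fin n → K} (hy : ∀ i, ‖y i‖ < 1)
    (P : MvPolynomial (Fin n) (integers K)) :
    evalFun K y (coeffFamily (P : MvPowerSeries (Fin n) (integers K))) =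
      MvPolynomial.eval₂ (integers K).subtype y P := by
  have := evalFun_coeffFamily_mul hy 1 P
  rwa [one_mul, evalFun_coeffFamily_one hy, one_mul] at this

end Integers

/-! ### Convergence and analyticity of the normalized rows -/

section Limits

variable {K : Type*} [NontriviallyNormedField K] [IsUltrametricDist K]

instance : IsLocalRing (integers K) := by
  refine IsLocalRing.of_nonunits_add fun a b ha hb => ?_
  rw [mem_nonunits_iff, isUnit_integers_iff] at *
  have ha' := lt_of_le_of_ne (norm_integers_le a) ha
  have hb' := lt_of_le_of_ne (norm_integers_le b) hb
  exact ((IsUltrametricDist.norm_add_le_max (a : K) b).trans_lt (max_lt ha' hb')).ne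

theorem not_isUnit_natCast_integers {p : ℕ} (hp : ‖(p : K)‖ < 1) : ¬ IsUnit (p : integers K) := by
  rw [isUnit_integers_iff]
  simpa using hp.ne

/-- The points with integral coordinates at which the first Hasse--Witt determinant is a unit. -/
def unitDomain (K : Type*) [NontriviallyNormedField K] (P q g : ℕ) :
    Set (Fin (q * g + 1) → K) :=
  {a | (∀ i, ‖a i‖ ≤ 1) ∧ ‖(hwMatrix (rootPoly a) P q g 1).det‖ = 1}

/-- The point over the ring of integers given by a point of `unitDomain`. -/
def toIntegers {P q g : ℕ} {a : Fin (q * g + 1) → K} (h : a ∈ unitDomain K P q g) :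
    Fin (q * g + 1) → integers K := fun i => ⟨a i, h.1 i⟩

theorem hwMatrix_rootPoly_map {R S : Type*} [CommRing R] [CommRing S] (φ : R →+* S) {n : ℕ}
    (z : Fin n → R) (P q g s : ℕ) : hwMatrix (rootPoly fun i => φ (z i)) P q g s =
      (hwMatrix (rootPoly z) P q g s).map φ := by
  rw [← map_rootPoly, hwMatrix_map]

theorem det_hwMatrix_rootPoly_map {R S : Type*} [CommRing R] [CommRing S] (φ : R →+* S) {n : ℕ}
    (z : Fin n → R) (P q g s : ℕ) : (hwMatrix (rootPoly fun i => φ (z i)) P q g s).det =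
      φ (hwMatrix (rootPoly z) P q g s).det := by
  rw [hwMatrix_rootPoly_map, RingHom.map_det]; rfl

theorem coe_det_hwMatrix {n : ℕ} (z : Fin n → integers K) (P q g s : ℕ) :
    ((hwMatrix (rootPoly z) P q g s).det : K) =
      (hwMatrix (rootPoly fun i => (z i : K)) P q g s).det :=
  (det_hwMatrix_rootPoly_map (integers K).subtype z P q g s).symm

variable {p e q g : ℕ} [Fact p.Prime]

theorem isUnit_det_toIntegers (ha : Admissible p e q g) (hp : ‖(p : K)‖ < 1)
    {a : Fin (q * g + 1) → K} (h : a ∈ unitDomain K (p ^ e) q g) {s : ℕ} (hs : 1 ≤ s) :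
    IsUnit (hwMatrix (rootPoly (toIntegers h)) (p ^ e) q g s).det := by
  refine isUnit_det_hwMatrix ha (not_isUnit_natCast_integers hp) (natDegree_rootPoly_le _) ?_ hs
  rw [isUnit_integers_iff, coe_det_hwMatrix]
  exact h.2

theorem norm_det_hwMatrix (ha : Admissible p e q g) (hp : ‖(p : K)‖ < 1)
    {a : Fin (q * g + 1) → K} (h : a ∈ unitDomain K (p ^ e) q g) {s : ℕ} (hs : 1 ≤ s) :
    ‖(hwMatrix (rootPoly a) (p ^ e) q g s).det‖ = 1 := by
  have h1 := isUnit_integers_iff.1 (isUnit_det_toIntegers ha hp h hs)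
  rwa [coe_det_hwMatrix] at h1

theorem isUnit_det_hwMatrix_of_mem (ha : Admissible p e q g) (hp : ‖(p : K)‖ < 1)
    {a : Fin (q * g + 1) → K} (h : a ∈ unitDomain K (p ^ e) q g) {s : ℕ} (hs : 1 ≤ s) :
    IsUnit (hwMatrix (rootPoly a) (p ^ e) q g s).det :=
  isUnit_iff_ne_zero.2 (norm_ne_zero_iff.1 (by
    rw [norm_det_hwMatrix ha hp h hs]; exact one_ne_zero))

theorem nrowAt_eq_coe (ha : Admissible p e q g) (hp : ‖(p : K)‖ < 1)
    {a : Fin (q * g + 1) → K} (h : a ∈ unitDomain K (p ^ e) q g) {s : ℕ} (hs : 1 ≤ s)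
    (k : Polynomial (MvPolynomial (Fin (q * g + 1)) ℤ)) (u : Fin g) :
    nrowAt (p ^ e) q g s k a u = (nrowAt (p ^ e) q g s k (toIntegers h) u : integers K) :=
  nrowAt_map (integers K).subtype (isUnit_det_toIntegers ha hp h hs) k u

theorem norm_nrowAt_sub_le (ha : Admissible p e q g) (hp : ‖(p : K)‖ < 1)
    {a : Fin (q * g + 1) → K} (h : a ∈ unitDomain K (p ^ e) q g) {i s : ℕ} (hi : 1 ≤ i)
    (his : i ≤ s) {k : Polynomial (MvPolynomial (Fin (q * g + 1)) ℤ)}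
    (hk : k.natDegree ≤ q * g + g) (u : Fin g) :
    ‖nrowAt (p ^ e) q g s k a u - nrowAt (p ^ e) q g i k a u‖ ≤ ‖(p : K)‖ ^ i := by
  obtain ⟨x, hx⟩ := dvd_nrowAt_sub_nrowAt ha (not_isUnit_natCast_integers hp)
    (isUnit_det_toIntegers ha hp h le_rfl) hi his hk u
  rw [nrowAt_eq_coe ha hp h hi, nrowAt_eq_coe ha hp h (hi.trans his), ← AddSubgroupClass.coe_sub, hx]
  have : (((p : integers K) ^ i * x : integers K) : K) = (p : K) ^ i * (x : K) := by simp
  rw [this, norm_mul, norm_pow]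
  exact mul_le_of_le_one_right (by positivity) (norm_integers_le x)

/-- The limit of the normalized rows `nrowAt`. -/
def limRow (P q g : ℕ) (k : Polynomial (MvPolynomial (Fin (q * g + 1)) ℤ))
    (a : Fin (q * g + 1) → K) (u : Fin g) : K :=
  limUnder atTop fun s => nrowAt P q g s k a u

/-- The points a and a + y have the same residues, hence the same reduced determinant. The domain is
therefore a union of open unit polydiscs. -/
theorem add_mem_unitDomain {P : ℕ} {a y : Fin (q * g + 1) → K} (h : a ∈ unitDomain K P q g)
    (hy : ∀ i, ‖y i‖ < 1) : a + y ∈ unitDomain K P q g := by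
  have hay : ∀ i, ‖(a + y) i‖ ≤ 1 := fun i =>
    (IsUltrametricDist.norm_add_le_max _ _).trans (max_le (h.1 i) (hy i).le)
  let b : Fin (q * g + 1) → integers K := fun i => ⟨(a + y) i, hay i⟩
  have hres : (fun i => IsLocalRing.residue (integers K) (b i)) =
      fun i => IsLocalRing.residue (integers K) (toIntegers h i) := by
    ext i
    rw [← sub_eq_zero, ← map_sub, IsLocalRing.residue_eq_zero_iff, IsLocalRing.mem_maximalIdeal,
      mem_nonunits_iff, isUnit_integers_iff, AddSubgroupClass.coe_sub]
    simpa [b, toIntegers] using (hy i).ne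
  refine ⟨hay, ?_⟩
  have h1 : IsUnit (hwMatrix (rootPoly (toIntegers h)) P q g 1).det := by
    rw [isUnit_integers_iff, coe_det_hwMatrix]
    exact h.2
  have h2 : IsUnit (hwMatrix (rootPoly b) P q g 1).det := by
    rw [← IsLocalRing.residue_ne_zero_iff_isUnit, ← det_hwMatrix_rootPoly_map] at h1 ⊢
    rwa [hres]
  rw [isUnit_integers_iff, coe_det_hwMatrix] at h2
  exact h2

theorem eventually_add_mem_unitDomain {P : ℕ} {a : Fin (q * g + 1) → K}
    (h : a ∈ unitDomain K P q g) : ∀ᶠ x in 𝓝 a, x ∈ unitDomain K P q g ∧ ∀ i, ‖(x - a) i‖ < 1 := by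
  have h1 : ∀ᶠ x in 𝓝 a, ‖x - a‖ < 1 := by
    filter_upwards [Metric.ball_mem_nhds a one_pos] with x hx
    rwa [Metric.mem_ball, dist_eq_norm] at hx
  filter_upwards [h1] with x hx
  have h2 : ∀ i, ‖(x - a) i‖ < 1 := fun i => (norm_le_pi_norm (x - a) i).trans_lt hx
  refine ⟨?_, h2⟩
  have := add_mem_unitDomain h h2
  rwa [add_sub_cancel] at this

variable [CompleteSpace K]

theorem exists_tendsto_of_norm_sub_le {E : Type*} [NormedAddCommGroup E] [CompleteSpace E]
    {r : ℝ} (h0 : 0 ≤ r) (h1 : r < 1) {x : ℕ → E}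
    (h : ∀ i s, 1 ≤ i → i ≤ s → ‖x s - x i‖ ≤ r ^ i) : ∃ y, Tendsto x atTop (𝓝 y) := by
  refine cauchySeq_tendsto_of_complete (Metric.cauchySeq_iff'.2 fun ε hε => ?_)
  obtain ⟨N, hN⟩ := exists_pow_lt_of_lt_one hε h1
  refine ⟨N + 1, fun s hs => ?_⟩
  rw [dist_eq_norm]
  refine (h (N + 1) s (by omega) hs).trans_lt (lt_of_le_of_lt ?_ hN)
  exact pow_le_pow_of_le_one h0 h1.le (Nat.le_succ N)

theorem tendsto_nrowAt (ha : Admissible p e q g) (hp : ‖(p : K)‖ < 1)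
    {a : Fin (q * g + 1) → K} (h : a ∈ unitDomain K (p ^ e) q g)
    {k : Polynomial (MvPolynomial (Fin (q * g + 1)) ℤ)} (hk : k.natDegree ≤ q * g + g)
    (u : Fin g) : Tendsto (fun s => nrowAt (p ^ e) q g s k a u) atTop
      (𝓝 (limRow (p ^ e) q g k a u)) :=
  tendsto_nhds_limUnder (exists_tendsto_of_norm_sub_le (norm_nonneg _) hp fun _ _ hi his =>
    norm_nrowAt_sub_le ha hp h hi his hk u)

theorem norm_limRow_sub_le (ha : Admissible p e q g) (hp : ‖(p : K)‖ < 1)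
    {a : Fin (q * g + 1) → K} (h : a ∈ unitDomain K (p ^ e) q g) {i : ℕ} (hi : 1 ≤ i)
    {k : Polynomial (MvPolynomial (Fin (q * g + 1)) ℤ)} (hk : k.natDegree ≤ q * g + g)
    (u : Fin g) :
    ‖limRow (p ^ e) q g k a u - nrowAt (p ^ e) q g i k a u‖ ≤ ‖(p : K)‖ ^ i := by
  refine le_of_tendsto ((tendsto_nrowAt ha hp h hk u).sub_const _).norm ?_
  filter_upwards [eventually_ge_atTop i] with s hs
  exact norm_nrowAt_sub_le ha hp h hi hs hk u

theorem tendstoUniformlyOn_nrowAt (ha : Admissible p e q g) (hp : ‖(p : K)‖ < 1)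
    {k : Polynomial (MvPolynomial (Fin (q * g + 1)) ℤ)} (hk : k.natDegree ≤ q * g + g)
    (u : Fin g) : TendstoUniformlyOn (fun s a => nrowAt (p ^ e) q g s k a u)
      (fun a => limRow (p ^ e) q g k a u) atTop (unitDomain K (p ^ e) q g) := by
  rw [Metric.tendstoUniformlyOn_iff]
  intro ε hε
  have h1 := (tendsto_pow_atTop_nhds_zero_of_lt_one (norm_nonneg (p : K)) hp).eventually_lt_const hε
  filter_upwards [h1, eventually_ge_atTop 1] with s hs hs1 a h
  rw [dist_eq_norm]
  exact (norm_limRow_sub_le ha hp h hs1 hk u).trans_lt hs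

/-- The congruences are applied over power series at the point a + X. A power series is a unit
exactly when its constant coefficient is, so the first determinant is a unit there. The same c and d
serve the whole open unit polydisc. -/
theorem exists_powerSeries_nrowAt (ha : Admissible p e q g) (hp : ‖(p : K)‖ < 1)
    {a : Fin (q * g + 1) → K} (h : a ∈ unitDomain K (p ^ e) q g)
    {k : Polynomial (MvPolynomial (Fin (q * g + 1)) ℤ)} (hk : k.natDegree ≤ q * g + g)
    (u : Fin g) : ∃ (c : ℕ → CoeffSpace K (q * g + 1)) (d : CoeffSpace K (q * g + 1)),
      Tendsto c atTop (𝓝 d) ∧ ∀ s, 1 ≤ s → ∀ y : Fin (q * g + 1) → K, (∀ i, ‖y i‖ < 1) →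
        nrowAt (p ^ e) q g s k (a + y) u = evalFun K y (c s) := by
  let W := MvPowerSeries (Fin (q * g + 1)) (integers K)
  let zP : Fin (q * g + 1) → MvPolynomial (Fin (q * g + 1)) (integers K) := fun i =>
    MvPolynomial.C (toIntegers h i) + MvPolynomial.X i
  let ψ : MvPolynomial (Fin (q * g + 1)) (integers K) →+* W :=
    MvPolynomial.coeToMvPowerSeries.ringHom
  let zW : Fin (q * g + 1) → W := fun i => ψ (zP i)
  have hpW : ¬ IsUnit (p : W) := by
    rw [MvPowerSeries.isUnit_iff_constantCoeff, map_natCast]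
    exact not_isUnit_natCast_integers hp
  have hcc : (fun i => MvPowerSeries.constantCoeff (zW i)) = toIntegers h := by
    funext i
    change MvPowerSeries.constantCoeff ((zP i : MvPolynomial _ (integers K)) : W) = _
    simp [zP]
  have h1 : IsUnit (hwMatrix (rootPoly zW) (p ^ e) q g 1).det := by
    rw [MvPowerSeries.isUnit_iff_constantCoeff, ← det_hwMatrix_rootPoly_map, hcc]
    exact isUnit_det_toIntegers ha hp h le_rfl
  let c : ℕ → CoeffSpace K (q * g + 1) := fun s => coeffFamily (nrowAt (p ^ e) q g s k zW u)
  obtain ⟨d, hd⟩ := exists_tendsto_of_norm_sub_le (x := c) (norm_nonneg _) hp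
    fun i s hi his => norm_coeffFamily_sub_le (dvd_nrowAt_sub_nrowAt ha hpW h1 hi his hk u)
  refine ⟨c, d, hd, fun s hs y hy => ?_⟩
  have hs1 := isUnit_det_hwMatrix ha hpW (natDegree_rootPoly_le zW) h1 hs
  let ε : MvPolynomial (Fin (q * g + 1)) (integers K) →+* K :=
    MvPolynomial.eval₂Hom (integers K).subtype y
  have hε : (fun i => ε (zP i)) = a + y := by
    ext i; simp [ε, zP, toIntegers]
  -- Evaluate the system nrow · A = row at y. Here A and the right side are polynomial, so
  -- evaluation respects the products; inverting A at a + y then identifies the evaluated series.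
  have h2 : Matrix.vecMul (fun u => evalFun K y (coeffFamily (nrowAt (p ^ e) q g s k zW u)))
      (hwMatrix (rootPoly (a + y)) (p ^ e) q g s) =
      row (rootPoly (a + y)) (p ^ e) q g s (k.map (spec (a + y))) := by
    have hε' : ∀ f, evalFun K y (coeffFamily (ψ f)) = ε f := evalFun_coeffFamily_coe hy
    ext l
    have h3 := congrArg (fun f => evalFun K y (coeffFamily f))
      (sum_nrow_mul hs1 (k.map (spec zW)) l)
    have h4 : row (rootPoly zW) (p ^ e) q g s (k.map (spec zW)) l =
        ψ (row (rootPoly zP) (p ^ e) q g s (k.map (spec zP)) l) := by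
      rw [← row_map, map_rootPoly, map_map_spec]
    have h5 : ∀ u : Fin g, row (rootPoly zW) (p ^ e) q g s
        (Polynomial.X ^ (u : ℕ) * rootPoly zW) l =
        ψ (hwMatrix (rootPoly zP) (p ^ e) q g s u l) := fun u =>
      congrFun (congrFun (hwMatrix_rootPoly_map ψ zP (p ^ e) q g s) u) l
    have h6 : ∀ (S : Finset (Fin g)) (f : Fin g → W),
        evalFun K y (coeffFamily (∑ u ∈ S, f u)) = ∑ u ∈ S, evalFun K y (coeffFamily (f u)) := by
      intro S f
      exact map_sum ((evalFun K y : CoeffSpace K (q * g + 1) →+ K).comp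
        (AddMonoidHom.mk' coeffFamily coeffFamily_add)) f S
    beta_reduce at h3
    rw [h4, hε', ← row_map, map_rootPoly, map_map_spec, hε, h6] at h3
    rw [← h3]
    simp only [Matrix.vecMul, dotProduct]
    refine Finset.sum_congr rfl fun u _ => ?_
    rw [h5]
    refine Eq.trans ?_ (evalFun_coeffFamily_mul hy _ _).symm
    rw [← hε, hwMatrix_rootPoly_map]
    rfl
  rw [nrowAt, nrow, ← h2, Matrix.vecMul_vecMul, Matrix.mul_nonsing_inv _
    (isUnit_det_hwMatrix_of_mem ha hp (add_mem_unitDomain h hy) hs), Matrix.vecMul_one]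

/-- Near a, level s is Λ(x) c_s and the limit is Λ(x) d, with one analytic operator-valued Λ and c_s
→ d. The derivatives are Λ'(a) v applied to c_s, so they converge by continuity of this functional.
-/
theorem analyticAt_limRow_and_tendsto_fderiv (ha : Admissible p e q g) (hp : ‖(p : K)‖ < 1)
    {a : Fin (q * g + 1) → K} (h : a ∈ unitDomain K (p ^ e) q g)
    {k : Polynomial (MvPolynomial (Fin (q * g + 1)) ℤ)} (hk : k.natDegree ≤ q * g + g)
    (u : Fin g) : AnalyticAt K (fun x => limRow (p ^ e) q g k x u) a ∧
      (∀ s, 1 ≤ s → DifferentiableAt K (fun x => nrowAt (p ^ e) q g s k x u) a) ∧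
      ∀ v, Tendsto (fun s => fderiv K (fun x => nrowAt (p ^ e) q g s k x u) a v) atTop
        (𝓝 (fderiv K (fun x => limRow (p ^ e) q g k x u) a v)) := by
  obtain ⟨c, d, hcd, hc⟩ := exists_powerSeries_nrowAt ha hp h hk u
  let Λ : (Fin (q * g + 1) → K) → CoeffSpace K (q * g + 1) →L[K] K := fun x => evalFun K (x - a)
  have hΛ : AnalyticAt K Λ a := by
    have h1 : AnalyticAt K (fun y : Fin (q * g + 1) → K => evalFun K y) (a - a) := by
      rw [sub_self]; exact analyticAt_evalFun
    exact h1.comp (f := fun x => x - a) (analyticAt_id.sub analyticAt_const)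
  have hs : ∀ s, 1 ≤ s → (fun x => nrowAt (p ^ e) q g s k x u) =ᶠ[𝓝 a] fun x => Λ x (c s) := by
    intro s hs
    filter_upwards [eventually_add_mem_unitDomain h] with x hx
    have := hc s hs (x - a) hx.2
    rwa [add_sub_cancel] at this
  have hlim : (fun x => limRow (p ^ e) q g k x u) =ᶠ[𝓝 a] fun x => Λ x d := by
    filter_upwards [eventually_add_mem_unitDomain h] with x hx
    refine tendsto_nhds_unique (tendsto_nrowAt ha hp hx.1 hk u) ?_
    refine (((Λ x).continuous.tendsto d).comp hcd).congr' ?_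
    filter_upwards [eventually_ge_atTop 1] with s hs
    have := hc s hs (x - a) hx.2
    rw [add_sub_cancel] at this
    exact this.symm
  have hder : ∀ (c : CoeffSpace K (q * g + 1)) v, fderiv K (fun x => Λ x c) a v =
      fderiv K Λ a v c := by
    intro c v
    have := (hΛ.differentiableAt.hasFDerivAt.clm_apply (hasFDerivAt_const c a)).fderiv
    rw [this]; simp
  refine ⟨(((ContinuousLinearMap.apply K K d).analyticAt (Λ a)).comp hΛ).congr hlim.symm,
    fun s hs1 => ?_, fun v => ?_⟩
  · exact ((((ContinuousLinearMap.apply K K (c s)).analyticAt (Λ a)).comp hΛ).congr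
      (hs s hs1).symm).differentiableAt
  rw [hlim.fderiv_eq, hder]
  refine (((fderiv K Λ a v).continuous.tendsto d).comp hcd).congr' ?_
  filter_upwards [eventually_ge_atTop 1] with s hs1
  rw [(hs s hs1).fderiv_eq, hder]
  rfl

end Limits

/-! ### Polynomial identities for the derivatives in z and in t -/

section Derivations

open Polynomial

variable {n : ℕ}

/-- The derivation `∂ / ∂ z_i` of `ℤ[z][t]`. -/
def polyDeriv (i : Fin n) : Derivation ℤ (MvPolynomial (Fin n) ℤ)[X] (MvPolynomial (Fin n) ℤ)[X] :=
  (PolynomialModule.equivPolynomialSelf (R := MvPolynomial (Fin n) ℤ)).toLinearMap.compDer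
    (MvPolynomial.pderiv i).mapCoeffs

theorem coeff_polyDeriv (i : Fin n) (f : (MvPolynomial (Fin n) ℤ)[X]) (m : ℕ) :
    (polyDeriv i f).coeff m = MvPolynomial.pderiv i (f.coeff m) := rfl

theorem polyDeriv_X (i : Fin n) : polyDeriv i X = 0 := by
  ext1 m
  rw [coeff_polyDeriv, coeff_X]
  split_ifs <;> simp

theorem polyDeriv_C (i : Fin n) (f : MvPolynomial (Fin n) ℤ) :
    polyDeriv i (C f) = C (MvPolynomial.pderiv i f) := by
  ext1 m
  rw [coeff_polyDeriv, coeff_C, coeff_C]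
  split_ifs <;> simp

theorem polyDeriv_cofactorPoly_self (i : Fin n) :
    polyDeriv i (cofactorPoly MvPolynomial.X i) = 0 := by
  refine Finset.prod_induction _ (fun f => polyDeriv i f = 0) ?_ ?_ ?_
  · intro f f' h h'
    rw [Derivation.leibniz, h, h', smul_zero, smul_zero, add_zero]
  · simp
  · intro j hj
    rw [map_sub, polyDeriv_X, polyDeriv_C, MvPolynomial.pderiv_X_of_ne (Finset.ne_of_mem_erase hj)]
    simp

theorem polyDeriv_rootPoly (i : Fin n) :
    polyDeriv i (rootPoly MvPolynomial.X) = -cofactorPoly MvPolynomial.X i := by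
  rw [← mul_cofactorPoly MvPolynomial.X i, Derivation.leibniz, polyDeriv_cofactorPoly_self,
    map_sub, polyDeriv_X, polyDeriv_C, MvPolynomial.pderiv_X_self]
  simp only [zero_sub, map_one, smul_eq_mul, mul_zero, zero_add]
  ring

theorem polyDeriv_rootPoly_pow (i : Fin n) (N : ℕ) :
    polyDeriv i (rootPoly MvPolynomial.X ^ (N + 1)) =
      -(((N + 1 : ℕ) : (MvPolynomial (Fin n) ℤ)[X]) *
        (cofactorPoly MvPolynomial.X i * rootPoly MvPolynomial.X ^ N)) := by
  rw [Derivation.leibniz_pow, polyDeriv_rootPoly, Nat.add_sub_cancel, nsmul_eq_mul, smul_eq_mul]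
  ring

theorem coeff_natCast_mul {R : Type*} [CommRing R] (N m : ℕ) (f : R[X]) :
    ((N : R[X]) * f).coeff m = (N : R) * f.coeff m := by
  rw [← C_eq_natCast, coeff_C_mul]

theorem pderiv_hwMatrix {P q g s : ℕ} (hs : 0 < expo P q s) (i : Fin n) (u l : Fin g) :
    MvPolynomial.pderiv i (hwMatrix (rootPoly MvPolynomial.X) P q g s u l) =
      -((expo P q s : MvPolynomial (Fin n) ℤ) * row (rootPoly MvPolynomial.X) P q g s
        (X ^ (u : ℕ) * cofactorPoly MvPolynomial.X i) l) := by
  obtain ⟨N, hN⟩ : ∃ N, expo P q s = N + 1 := ⟨_, (Nat.sub_add_cancel hs).symm⟩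
  rw [hwMatrix, Matrix.of_apply, row, row, ← coeff_polyDeriv, hN, Nat.add_sub_cancel, mul_assoc,
    ← pow_succ', Derivation.leibniz, polyDeriv_rootPoly_pow, Derivation.leibniz_pow, polyDeriv_X,
    ← coeff_natCast_mul, ← coeff_neg]
  congr 1
  simp only [smul_eq_mul, mul_zero, nsmul_zero, add_zero]
  push_cast
  ring

/-- Partial fractions: (z_i - z_j) / ((t - z_i)(t - z_j)) = 1/(t - z_i) - 1/(t - z_j). -/
theorem sub_mul_pderiv_row_cofactorPoly {P q g s : ℕ} (hs : 0 < expo P q s) (i j : Fin n)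
    (hij : i ≠ j) (l : Fin g) :
    (MvPolynomial.X i - MvPolynomial.X j) * MvPolynomial.pderiv i
        (row (rootPoly MvPolynomial.X) P q g s (cofactorPoly MvPolynomial.X j) l) =
      -((expo P q s : MvPolynomial (Fin n) ℤ) *
        (row (rootPoly MvPolynomial.X) P q g s (cofactorPoly MvPolynomial.X i) l -
          row (rootPoly MvPolynomial.X) P q g s (cofactorPoly MvPolynomial.X j) l)) := by
  obtain ⟨N, hN⟩ : ∃ N, expo P q s = N + 1 := ⟨_, (Nat.sub_add_cancel hs).symm⟩
  simp only [row, hN, Nat.add_sub_cancel]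
  rw [← coeff_polyDeriv, ← coeff_C_mul, ← coeff_sub, ← coeff_natCast_mul, ← coeff_neg]
  congr 1
  set G := fun j : Fin n => cofactorPoly (MvPolynomial.X (R := ℤ)) j with hG
  set F : (MvPolynomial (Fin n) ℤ)[X] := rootPoly MvPolynomial.X with hF
  have hGj : (X - C (MvPolynomial.X j)) * G j = F := mul_cofactorPoly _ j
  have hGi : (X - C (MvPolynomial.X i)) * G i = F := mul_cofactorPoly _ i
  have h1 : (X - C (MvPolynomial.X j)) * polyDeriv i (G j * F ^ N) =
      -(((N + 1 : ℕ) : (MvPolynomial (Fin n) ℤ)[X]) * (G i * F ^ N)) := by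
    have h2 : (X - C (MvPolynomial.X j)) * (G j * F ^ N) = F ^ (N + 1) := by
      rw [← mul_assoc, hGj, pow_succ']
    have h3 := congrArg (polyDeriv i) h2
    rw [Derivation.leibniz, map_sub, polyDeriv_X, polyDeriv_C,
      MvPolynomial.pderiv_X_of_ne hij.symm, polyDeriv_rootPoly_pow] at h3
    simpa using h3
  -- The identity is checked after multiplication by t - z_j, which clears the denominator of F/(t -
  -- z_j).
  apply mul_left_cancel₀ (monic_X_sub_C (MvPolynomial.X j : MvPolynomial (Fin n) ℤ)).ne_zero
  calc (X - C (MvPolynomial.X j)) * (C (MvPolynomial.X i - MvPolynomial.X j) *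
        polyDeriv i (G j * F ^ N))
      = C (MvPolynomial.X i - MvPolynomial.X j) *
        ((X - C (MvPolynomial.X j)) * polyDeriv i (G j * F ^ N)) := by ring
    _ = -(((N + 1 : ℕ) : (MvPolynomial (Fin n) ℤ)[X]) *
        (((X - C (MvPolynomial.X j)) * G i - (X - C (MvPolynomial.X i)) * G i) * F ^ N)) := by
        rw [h1, C_sub]; ring
    _ = _ := by
        rw [hGi, ← hGj]; ring

/-- The left side is a coefficient of the t-derivative of F^(N_s). At t^(l P^s - 1) differentiation
produces the factor l P^s, which tends to zero p-adically. -/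
theorem sum_row_cofactorPoly {R : Type*} [CommRing R] {P q g s : ℕ} (hs : 0 < expo P q s)
    (z : Fin n → R) (l : Fin g) (hP : 0 < P) :
    (expo P q s : R) * ∑ j, row (rootPoly z) P q g s (cofactorPoly z j) l =
      ((((l : ℕ) + 1 : ℕ) : R) * (P : R) ^ s) *
        (rootPoly z ^ expo P q s).coeff (((l : ℕ) + 1) * P ^ s) := by
  obtain ⟨N, hN⟩ : ∃ N, expo P q s = N + 1 := ⟨_, (Nat.sub_add_cancel hs).symm⟩
  have h1 : derivative (rootPoly z) = ∑ j, cofactorPoly z j := by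
    rw [rootPoly, derivative_prod_finset]
    simp [cofactorPoly]
  have h2 : derivative (rootPoly z ^ (N + 1)) =
      ((N + 1 : ℕ) : R[X]) * ∑ j, cofactorPoly z j * rootPoly z ^ N := by
    rw [derivative_pow, h1, ← Finset.sum_mul, Nat.add_sub_cancel, C_eq_natCast]; ring
  have h3 := congrArg (fun f => f.coeff (((l : ℕ) + 1) * P ^ s - 1)) h2
  have h4 : 0 < ((l : ℕ) + 1) * P ^ s := by positivity
  simp only [coeff_natCast_mul, finsetSum_coeff, coeff_derivative, Nat.sub_add_cancel h4] at h3
  simp only [row, hN, Nat.add_sub_cancel]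
  rw [← h3, mul_comm]
  congr 1
  have h5 : ((((l : ℕ) + 1) * P ^ s - 1 : ℕ) : R) + 1 = ((((l : ℕ) + 1) * P ^ s : ℕ) : R) := by
    rw [← Nat.cast_succ, Nat.succ_eq_add_one, Nat.sub_add_cancel h4]
  rw [h5]
  push_cast
  ring

end Derivations

/-! ### Partial derivatives of evaluated polynomials -/

section Evaluation

variable {K : Type*} [NontriviallyNormedField K] {n : ℕ}

theorem differentiableAt_spec (f : MvPolynomial (Fin n) ℤ) (a : Fin n → K) :
    DifferentiableAt K (fun x => spec x f) a :=
  (AnalyticAt.aeval_mvPolynomial (fun i =>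
    (ContinuousLinearMap.proj (R := K) (φ := fun _ : Fin n => K) i).analyticAt a) f).differentiableAt

theorem fderiv_spec (f : MvPolynomial (Fin n) ℤ) (a : Fin n → K) (i : Fin n) :
    fderiv K (fun x => spec x f) a (Pi.single i 1) = spec a (MvPolynomial.pderiv i f) := by
  induction f using MvPolynomial.induction_on with
  | C m => simp
  | add f f' h h' =>
    simp only [map_add]
    rw [fderiv_fun_add (differentiableAt_spec f a) (differentiableAt_spec f' a), _root_.add_apply,
      h, h']
  | mul_X f j h =>
    have h2 : HasFDerivAt (fun x : Fin n → K => spec x (MvPolynomial.X j : MvPolynomial (Fin n) ℤ))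
        (ContinuousLinearMap.proj (R := K) (φ := fun _ : Fin n => K) j) a := by
      simp only [spec_X]
      exact (ContinuousLinearMap.proj (R := K) (φ := fun _ : Fin n => K) j).hasFDerivAt
    have h3 := ((differentiableAt_spec f a).hasFDerivAt.fun_mul h2).fderiv
    simp only [map_mul]
    rw [h3, Derivation.leibniz, MvPolynomial.pderiv_X]
    simp only [_root_.add_apply, _root_.smul_apply, h, map_add, smul_eq_mul, map_mul, spec_X,
      ContinuousLinearMap.proj_apply, Pi.single_apply]
    split_ifs <;> simp

end Evaluation

/-! ### Derivatives of the frame at finite level and in the limit -/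

section Connection

variable {K : Type*} [NontriviallyNormedField K] [IsUltrametricDist K]
variable {p e q g : ℕ} [Fact p.Prime]

theorem Admissible.expo_pos {p e q g : ℕ} [Fact p.Prime] (ha : Admissible p e q g) {s : ℕ}
    (hs : 1 ≤ s) : 0 < expo (p ^ e) q s :=
  PadicKZ.expo_pos ha.one_lt ha.dvd hs

theorem natDegree_cofactorPoly_X_le (i : Fin (q * g + 1)) :
    (cofactorPoly (MvPolynomial.X (R := ℤ)) i).natDegree ≤ q * g + g :=
  (natDegree_cofactorPoly_le _ i).trans (by omega)

/-- The polynomial `t ^ w (t - z_1) ⋯ (t - z_n) / (t - z_i)` over `ℤ[z]`. -/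
def cofactorMoment {n : ℕ} (i : Fin n) (w : ℕ) : Polynomial (MvPolynomial (Fin n) ℤ) :=
  Polynomial.X ^ w * cofactorPoly MvPolynomial.X i

theorem map_spec_cofactorMoment {n : ℕ} {R : Type*} [CommRing R] (z : Fin n → R) (i : Fin n)
    (w : ℕ) : (cofactorMoment i w).map (spec z) = Polynomial.X ^ w * cofactorPoly z i := by
  rw [cofactorMoment, Polynomial.map_mul, Polynomial.map_pow, Polynomial.map_X,
    map_spec_cofactorPoly]

theorem natDegree_cofactorMoment_le (i : Fin (q * g + 1)) (w : Fin g) :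
    (cofactorMoment i (w : ℕ)).natDegree ≤ q * g + g := by
  refine Polynomial.natDegree_mul_le.trans ?_
  have h1 := natDegree_cofactorPoly_le (MvPolynomial.X (R := ℤ)) i
  have h2 := Polynomial.natDegree_X_pow_le (R := MvPolynomial (Fin (q * g + 1)) ℤ) (w : ℕ)
  have h3 := w.2
  omega

theorem tendsto_pow_natCast {K : Type*} [NontriviallyNormedField K] {p e : ℕ} (he : 1 ≤ e) (hp : ‖(p : K)‖ < 1) :
    Tendsto (fun s => (((p ^ e : ℕ) : K)) ^ s) atTop (𝓝 0) := by
  apply tendsto_pow_atTop_nhds_zero_of_norm_lt_one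
  rw [Nat.cast_pow, norm_pow]
  exact pow_lt_one₀ (norm_nonneg _) hp (by omega)

/-- This is where the factor 1/q of the KZ connection comes from: q N_s = P^s - 1 and P^s → 0. -/
theorem tendsto_expo [CharZero K] (ha : Admissible p e q g) (hp : ‖(p : K)‖ < 1) :
    Tendsto (fun s => (expo (p ^ e) q s : K)) atTop (𝓝 (-(q : K)⁻¹)) := by
  have hq : (q : K) ≠ 0 := Nat.cast_ne_zero.2 ha.q_pos.ne'
  have h1 : ∀ s, (expo (p ^ e) q s : K) = (q : K)⁻¹ * (((p ^ e : ℕ) : K) ^ s - 1) := by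
    intro s
    rw [eq_inv_mul_iff_mul_eq₀ hq, ← Nat.cast_mul, mul_expo ha.dvd,
      Nat.cast_sub (Nat.one_le_pow _ _ (by have := ha.one_lt; omega)), Nat.cast_pow, Nat.cast_one]
  simp only [h1]
  have h2 := ((tendsto_pow_natCast ha.e_pos hp).sub_const 1).const_mul (q : K)⁻¹
  simpa using h2

theorem spec_row {n : ℕ} {R : Type*} [CommRing R] (z : Fin n → R) (P q g s : ℕ)
    (k : Polynomial (MvPolynomial (Fin n) ℤ)) (l : Fin g) :
    spec z (row (rootPoly MvPolynomial.X) P q g s k l) =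
      row (rootPoly z) P q g s (k.map (spec z)) l := by
  rw [← row_map, map_spec_rootPoly]

theorem spec_hwMatrix {n : ℕ} {R : Type*} [CommRing R] (z : Fin n → R) (P q g s : ℕ)
    (u l : Fin g) : spec z (hwMatrix (rootPoly MvPolynomial.X) P q g s u l) =
      hwMatrix (rootPoly z) P q g s u l := by
  rw [← map_spec_rootPoly z, hwMatrix_map]; rfl

theorem sum_nrowAt_mul {n : ℕ} {R : Type*} [CommRing R] {z : Fin n → R} {P q g s : ℕ}
    (h : IsUnit (hwMatrix (rootPoly z) P q g s).det) (k : Polynomial (MvPolynomial (Fin n) ℤ))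
    (l : Fin g) : ∑ u, nrowAt P q g s k z u * hwMatrix (rootPoly z) P q g s u l =
      row (rootPoly z) P q g s (k.map (spec z)) l :=
  sum_nrow_mul h _ l

/-- The sums of the rows of the solutions vanish in the limit. -/
theorem sum_limRow_cofactorPoly [CompleteSpace K] [CharZero K] (ha : Admissible p e q g)
    (hp : ‖(p : K)‖ < 1) {a : Fin (q * g + 1) → K} (h : a ∈ unitDomain K (p ^ e) q g) (u : Fin g) :
    ∑ j, limRow (p ^ e) q g (cofactorPoly MvPolynomial.X j) a u = 0 := by
  have hq : (q : K) ≠ 0 := Nat.cast_ne_zero.2 ha.q_pos.ne'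
  have h1 : Tendsto (fun s => (expo (p ^ e) q s : K) *
      ∑ j, nrowAt (p ^ e) q g s (cofactorPoly MvPolynomial.X j) a u) atTop
      (𝓝 (-(q : K)⁻¹ * ∑ j, limRow (p ^ e) q g (cofactorPoly MvPolynomial.X j) a u)) :=
    (tendsto_expo ha hp).mul (tendsto_finsetSum _ fun j _ =>
      tendsto_nrowAt ha hp h (natDegree_cofactorPoly_X_le j) u)
  -- The computation is made over the integers, so that the cofactor of P^s, which involves A_s⁻¹,
  -- is bounded.
  have h2 : ∀ s, 1 ≤ s → ∃ y : integers K, (expo (p ^ e) q s : K) *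
      ∑ j, nrowAt (p ^ e) q g s (cofactorPoly MvPolynomial.X j) a u =
        ((p ^ e : ℕ) : K) ^ s * (y : K) := by
    intro s hs
    have h3 : (expo (p ^ e) q s : integers K) *
        ∑ j, nrowAt (p ^ e) q g s (cofactorPoly MvPolynomial.X j) (toIntegers h) u =
        ∑ l : Fin g, ((expo (p ^ e) q s : integers K) * ∑ j, row (rootPoly (toIntegers h)) (p ^ e)
          q g s (cofactorPoly (toIntegers h) j) l) *
          (hwMatrix (rootPoly (toIntegers h)) (p ^ e) q g s)⁻¹ l u := by
      simp only [nrowAt, nrow, Matrix.vecMul, dotProduct, map_spec_cofactorPoly]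
      rw [Finset.sum_comm, Finset.mul_sum]
      simp only [Finset.mul_sum, Finset.sum_mul, mul_assoc]
    simp only [sum_row_cofactorPoly (ha.expo_pos hs) _ _ (zero_lt_one.trans ha.one_lt)] at h3
    refine ⟨∑ l : Fin g, (((l : ℕ) + 1 : ℕ) : integers K) * (rootPoly (toIntegers h) ^
      expo (p ^ e) q s).coeff (((l : ℕ) + 1) * (p ^ e) ^ s) *
      (hwMatrix (rootPoly (toIntegers h)) (p ^ e) q g s)⁻¹ l u, ?_⟩
    have h4 := congrArg (integers K).subtype h3
    have h5 : ∀ j, (integers K).subtype (nrowAt (p ^ e) q g s (cofactorPoly MvPolynomial.X j)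
        (toIntegers h) u) = nrowAt (p ^ e) q g s (cofactorPoly MvPolynomial.X j) a u := fun j =>
      (nrowAt_eq_coe ha hp h hs _ u).symm
    rw [map_mul, map_sum, Finset.sum_congr rfl fun j _ => h5 j, map_natCast] at h4
    rw [h4, map_sum, ← Subring.coe_subtype, map_sum, Finset.mul_sum]
    refine Finset.sum_congr rfl fun l _ => ?_
    simp only [map_mul, map_pow, map_natCast]
    ring
  have h3 : Tendsto (fun s => (expo (p ^ e) q s : K) *
      ∑ j, nrowAt (p ^ e) q g s (cofactorPoly MvPolynomial.X j) a u) atTop (𝓝 0) := by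
    refine squeeze_zero_norm' ?_ (tendsto_zero_iff_norm_tendsto_zero.1
      (tendsto_pow_natCast (K := K) ha.e_pos hp))
    filter_upwards [eventually_ge_atTop 1] with s hs
    obtain ⟨y, hy⟩ := h2 s hs
    rw [hy, norm_mul]
    exact mul_le_of_le_one_right (norm_nonneg _) (norm_integers_le y)
  exact (mul_eq_zero.1 (tendsto_nhds_unique h1 h3)).resolve_left (neg_ne_zero.2 (inv_ne_zero hq))

variable [CompleteSpace K]

/-- Leibniz rule for nrow · A = row, solved for ∂_i(nrow) · A. -/
theorem sum_fderiv_nrowAt_mul (ha : Admissible p e q g) (hp : ‖(p : K)‖ < 1)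
    {a : Fin (q * g + 1) → K} (h : a ∈ unitDomain K (p ^ e) q g) {s : ℕ} (hs : 1 ≤ s)
    {k : Polynomial (MvPolynomial (Fin (q * g + 1)) ℤ)} (hk : k.natDegree ≤ q * g + g)
    (i : Fin (q * g + 1)) (l : Fin g) :
    ∑ u, fderiv K (fun x => nrowAt (p ^ e) q g s k x u) a (Pi.single i 1) *
        hwMatrix (rootPoly a) (p ^ e) q g s u l =
      spec a (MvPolynomial.pderiv i (row (rootPoly MvPolynomial.X) (p ^ e) q g s k l)) +
        (expo (p ^ e) q s : K) * ∑ u, nrowAt (p ^ e) q g s k a u *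
          row (rootPoly a) (p ^ e) q g s (Polynomial.X ^ (u : ℕ) * cofactorPoly a i) l := by
  have h1 : (fun x : Fin (q * g + 1) → K => ∑ u, nrowAt (p ^ e) q g s k x u *
      spec x (hwMatrix (rootPoly MvPolynomial.X) (p ^ e) q g s u l)) =ᶠ[𝓝 a]
      fun x => spec x (row (rootPoly MvPolynomial.X) (p ^ e) q g s k l) := by
    filter_upwards [eventually_add_mem_unitDomain h] with x hx
    rw [spec_row, ← sum_nrowAt_mul (isUnit_det_hwMatrix_of_mem ha hp hx.1 hs)]
    simp only [spec_hwMatrix]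
  have h2 := DFunLike.congr_fun (h1.fderiv_eq (𝕜 := K)) (Pi.single i 1)
  have hd : ∀ u, DifferentiableAt K (fun x => nrowAt (p ^ e) q g s k x u) a := fun u =>
    (analyticAt_limRow_and_tendsto_fderiv ha hp h hk u).2.1 s hs
  have h3 := (HasFDerivAt.fun_sum (u := Finset.univ) fun (u : Fin g) _ =>
    ((hd u).fun_mul (differentiableAt_spec (hwMatrix (rootPoly MvPolynomial.X) (p ^ e) q g s u l)
      a)).hasFDerivAt).fderiv
  rw [fderiv_spec, h3] at h2
  simp only [_root_.sum_apply] at h2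
  rw [← h2, Finset.mul_sum, ← Finset.sum_add_distrib]
  refine Finset.sum_congr rfl fun u _ => ?_
  rw [fderiv_fun_mul (hd u) (differentiableAt_spec _ a)]
  rw [_root_.add_apply, _root_.smul_apply, _root_.smul_apply, fderiv_spec,
    pderiv_hwMatrix (ha.expo_pos hs)]
  simp only [smul_eq_mul, map_neg, map_mul, map_natCast, spec_row, spec_hwMatrix,
    Polynomial.map_mul, Polynomial.map_pow, Polynomial.map_X, map_spec_cofactorPoly]
  ring

theorem fderiv_nrowAt_cofactorPoly (ha : Admissible p e q g) (hp : ‖(p : K)‖ < 1)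
    {a : Fin (q * g + 1) → K} (h : a ∈ unitDomain K (p ^ e) q g) {s : ℕ} (hs : 1 ≤ s)
    {i j : Fin (q * g + 1)} (hij : i ≠ j) (haij : a i ≠ a j) (u : Fin g) :
    fderiv K (fun x => nrowAt (p ^ e) q g s (cofactorPoly MvPolynomial.X j) x u) a
        (Pi.single i 1) = (expo (p ^ e) q s : K) *
      ((∑ w : Fin g, nrowAt (p ^ e) q g s (cofactorPoly MvPolynomial.X j) a w *
        nrowAt (p ^ e) q g s (cofactorMoment i (w : ℕ)) a u) -
      (a i - a j)⁻¹ * (nrowAt (p ^ e) q g s (cofactorPoly MvPolynomial.X i) a u -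
        nrowAt (p ^ e) q g s (cofactorPoly MvPolynomial.X j) a u)) := by
  have hu := isUnit_det_hwMatrix_of_mem ha hp h hs
  have hsub : a i - a j ≠ 0 := sub_ne_zero.2 haij
  revert u
  rw [← funext_iff]
  -- Multiplication by A_s is injective and turns normalized rows back into coefficients of
  -- polynomials.
  apply Matrix.vecMul_injective_of_isUnit ((Matrix.isUnit_iff_isUnit_det _).2 hu)
  ext l
  have h1 : spec a (MvPolynomial.pderiv i (row (rootPoly MvPolynomial.X) (p ^ e) q g s
      (cofactorPoly MvPolynomial.X j) l)) = (a i - a j)⁻¹ * -((expo (p ^ e) q s : K) *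
        (row (rootPoly a) (p ^ e) q g s (cofactorPoly a i) l -
          row (rootPoly a) (p ^ e) q g s (cofactorPoly a j) l)) := by
    rw [eq_inv_mul_iff_mul_eq₀ hsub]
    have := congrArg (spec a) (sub_mul_pderiv_row_cofactorPoly (g := g) (ha.expo_pos hs) i j hij l)
    simpa only [map_mul, map_sub, map_neg, spec_X, map_natCast, spec_row, map_spec_cofactorPoly]
      using this
  have h2 := sum_fderiv_nrowAt_mul ha hp h hs (natDegree_cofactorPoly_X_le j) i l
  rw [h1] at h2
  simp only [Matrix.vecMul, dotProduct]
  rw [h2]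
  have h3 : ∀ k : Polynomial (MvPolynomial (Fin (q * g + 1)) ℤ),
      row (rootPoly a) (p ^ e) q g s (k.map (spec a)) l =
        ∑ u, nrowAt (p ^ e) q g s k a u * hwMatrix (rootPoly a) (p ^ e) q g s u l := fun k =>
    (sum_nrowAt_mul hu k l).symm
  have h4 : ∀ w : Fin g, row (rootPoly a) (p ^ e) q g s
      (Polynomial.X ^ (w : ℕ) * cofactorPoly a i) l =
      ∑ u, nrowAt (p ^ e) q g s (cofactorMoment i (w : ℕ)) a u *
        hwMatrix (rootPoly a) (p ^ e) q g s u l := by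
    intro w
    rw [← h3, map_spec_cofactorMoment]
  rw [← map_spec_cofactorPoly a i, ← map_spec_cofactorPoly a j, h3, h3, map_spec_cofactorPoly]
  simp only [h4, sub_mul, mul_sub, Finset.sum_sub_distrib, Finset.mul_sum, Finset.sum_mul,
    mul_neg]
  rw [Finset.sum_comm]
  simp only [mul_assoc, mul_left_comm ((a i - a j)⁻¹)]
  ring

/-- The matrix of the Gauss--Manin connection on the frame. -/
def connMatrix (P q g : ℕ) (i : Fin (q * g + 1)) (a : Fin (q * g + 1) → K) :
    Matrix (Fin g) (Fin g) K :=
  Matrix.of fun w u => limRow P q g (cofactorMoment i (w : ℕ)) a u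

/-- The limit frame, in terms of normalized rows. -/
def limFrame (P q g : ℕ) (a : Fin (q * g + 1) → K) : Matrix (Fin (q * g + 1)) (Fin g) K :=
  Matrix.of fun j u => limRow P q g (cofactorPoly MvPolynomial.X j) a u

variable [CharZero K]

theorem fderiv_limFrame_of_ne (ha : Admissible p e q g) (hp : ‖(p : K)‖ < 1)
    {a : Fin (q * g + 1) → K} (h : a ∈ unitDomain K (p ^ e) q g)
    {i j : Fin (q * g + 1)} (hij : i ≠ j) (haij : a i ≠ a j) (u : Fin g) :
    fderiv K (fun x => limFrame (p ^ e) q g x j u) a (Pi.single i 1) =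
      (q : K)⁻¹ * ((a i - a j)⁻¹ * (limFrame (p ^ e) q g a i u - limFrame (p ^ e) q g a j u) -
        (limFrame (p ^ e) q g a * connMatrix (p ^ e) q g i a) j u) := by
  have h1 := (analyticAt_limRow_and_tendsto_fderiv ha hp h
    (natDegree_cofactorPoly_X_le j) u).2.2 (Pi.single i 1)
  refine tendsto_nhds_unique h1 ?_
  have hX : ∀ (j : Fin (q * g + 1)) (u : Fin g), Tendsto (fun s => nrowAt (p ^ e) q g s
      (cofactorPoly MvPolynomial.X j) a u) atTop (𝓝 (limFrame (p ^ e) q g a j u)) := fun j u =>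
    tendsto_nrowAt ha hp h (natDegree_cofactorPoly_X_le j) u
  have hJ : ∀ (w u : Fin g), Tendsto (fun s => nrowAt (p ^ e) q g s
      (cofactorMoment i (w : ℕ)) a u) atTop
      (𝓝 (connMatrix (p ^ e) q g i a w u)) := fun w u =>
    tendsto_nrowAt ha hp h (natDegree_cofactorMoment_le i w) u
  have h2 := (tendsto_expo ha hp).mul ((tendsto_finsetSum Finset.univ fun w _ =>
    (hX j w).mul (hJ w u)).sub (((hX i u).sub (hX j u)).const_mul (a i - a j)⁻¹))
  refine (h2.congr' ?_).trans_eq ?_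
  · filter_upwards [eventually_ge_atTop 1] with s hs
    rw [fderiv_nrowAt_cofactorPoly ha hp h hs hij haij]
  · rw [Matrix.mul_apply]
    congr 1
    ring

end Connection

/-! ### Action of the Gaudin Hamiltonians -/

section Gaudin

variable {K : Type*} [NontriviallyNormedField K]

theorem Omega_mulVec {n : ℕ} (i j : Fin n) (v : Fin n → K) :
    (Omega K i j).mulVec v = (v j - v i) • (Pi.single i 1 - Pi.single j 1) := by
  ext k
  simp only [Omega, Matrix.sub_mulVec, Matrix.add_mulVec, Matrix.single_mulVec, Pi.sub_apply,
    Pi.add_apply, Pi.smul_apply, Pi.single_apply, Function.update_apply, Pi.zero_apply, one_mul,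
    smul_eq_mul]
  split_ifs <;> ring

theorem gaudin_mulVec (q : ℕ) {n : ℕ} (i : Fin n) (z v : Fin n → K) :
    (gaudin q i z).mulVec v = (q : K)⁻¹ • ∑ j ∈ Finset.univ.erase i,
      ((z i - z j)⁻¹ * (v j - v i)) • (Pi.single i 1 - Pi.single j 1) := by
  simp only [gaudin, Matrix.smul_mulVec, Matrix.sum_mulVec, Omega_mulVec, mul_smul]

theorem gaudin_mulVec_apply_of_ne (q : ℕ) {n : ℕ} {i j : Fin n} (hij : i ≠ j) (z v : Fin n → K) :
    (gaudin q i z).mulVec v j = (q : K)⁻¹ * ((z i - z j)⁻¹ * (v i - v j)) := by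
  rw [gaudin_mulVec, Pi.smul_apply, Finset.sum_apply, smul_eq_mul,
    Finset.sum_eq_single_of_mem j (Finset.mem_erase.2 ⟨hij.symm, Finset.mem_univ _⟩)]
  · simp [hij.symm]; ring
  · intro k _ hkj
    simp [hij.symm, hkj.symm]

theorem sum_gaudin_mulVec (q : ℕ) {n : ℕ} (i : Fin n) (z v : Fin n → K) :
    ∑ k, (gaudin q i z).mulVec v k = 0 := by
  rw [gaudin_mulVec]
  simp only [Pi.smul_apply, Finset.sum_apply, Pi.sub_apply, smul_eq_mul, ← Finset.mul_sum]
  rw [Finset.sum_comm, Finset.sum_eq_zero, mul_zero]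
  intro j _
  rw [← Finset.mul_sum, Finset.sum_sub_distrib]
  simp

end Gaudin

/-! ### The covariant derivative of a combination of the columns -/

section Invariance

theorem analyticAt_mulVec {K : Type*} [NontriviallyNormedField K] {m n : ℕ} {E : Type*} [NormedAddCommGroup E] [NormedSpace K E]
    {M : E → Matrix (Fin m) (Fin n) K} {c : E → Fin n → K} {a : E}
    (hM : ∀ i j, AnalyticAt K (fun x => M x i j) a) (hc : AnalyticAt K c a) :
    AnalyticAt K (fun x => (M x).mulVec (c x)) a := by
  rw [analyticAt_pi_iff] at hc ⊢
  intro i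
  simp only [Matrix.mulVec, dotProduct]
  exact Finset.analyticAt_fun_sum _ fun j _ => (hM i j).mul (hc j)

variable {K : Type*} [NontriviallyNormedField K] [IsUltrametricDist K] [CompleteSpace K]
variable {p e q g : ℕ} [Fact p.Prime]

theorem analyticAt_limFrame (ha : Admissible p e q g) (hp : ‖(p : K)‖ < 1)
    {a : Fin (q * g + 1) → K} (h : a ∈ unitDomain K (p ^ e) q g) (j : Fin (q * g + 1))
    (u : Fin g) : AnalyticAt K (fun x => limFrame (p ^ e) q g x j u) a :=
  (analyticAt_limRow_and_tendsto_fderiv ha hp h (natDegree_cofactorPoly_X_le j) u).1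

theorem analyticAt_connMatrix (ha : Admissible p e q g) (hp : ‖(p : K)‖ < 1)
    {a : Fin (q * g + 1) → K} (h : a ∈ unitDomain K (p ^ e) q g) (i : Fin (q * g + 1))
    (w u : Fin g) : AnalyticAt K (fun x => connMatrix (p ^ e) q g i x w u) a :=
  (analyticAt_limRow_and_tendsto_fderiv ha hp h (natDegree_cofactorMoment_le i w) u).1

/-- The coefficients of the covariant derivative of a section with coefficients `c`. -/
def covDeriv (P q g : ℕ) (i : Fin (q * g + 1)) (c : (Fin (q * g + 1) → K) → Fin g → K)
    (z : Fin (q * g + 1) → K) : Fin g → K :=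
  fderiv K c z (Pi.single i 1) - (q : K)⁻¹ • (connMatrix P q g i z).mulVec (c z)

theorem analyticAt_covDeriv (ha : Admissible p e q g) (hp : ‖(p : K)‖ < 1)
    {a : Fin (q * g + 1) → K} (h : a ∈ unitDomain K (p ^ e) q g) (i : Fin (q * g + 1))
    {c : (Fin (q * g + 1) → K) → Fin g → K} (hc : AnalyticAt K c a) :
    AnalyticAt K (covDeriv (p ^ e) q g i c) a := by
  refine AnalyticAt.sub ?_ (AnalyticAt.fun_const_smul
    (analyticAt_mulVec (fun w u => analyticAt_connMatrix ha hp h i w u) hc))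
  exact ((ContinuousLinearMap.apply K (Fin g → K) (Pi.single i 1)).analyticAt _).comp hc.fderiv

variable [CharZero K]

/-- For j ≠ i this is the limit formula already obtained. The remaining coordinate j = i follows
because both sides have coordinate sum zero. -/
theorem fderiv_limFrame (ha : Admissible p e q g) (hp : ‖(p : K)‖ < 1)
    {a : Fin (q * g + 1) → K} (h : a ∈ unitDomain K (p ^ e) q g)
    (hd : ∀ i j, i ≠ j → a i ≠ a j) (i j : Fin (q * g + 1)) (u : Fin g) :
    fderiv K (fun x => limFrame (p ^ e) q g x j u) a (Pi.single i 1) =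
      (gaudin q i a).mulVec (fun k => limFrame (p ^ e) q g a k u) j -
        (q : K)⁻¹ * (limFrame (p ^ e) q g a * connMatrix (p ^ e) q g i a) j u := by
  have hne : ∀ j, i ≠ j → fderiv K (fun x => limFrame (p ^ e) q g x j u) a (Pi.single i 1) =
      (gaudin q i a).mulVec (fun k => limFrame (p ^ e) q g a k u) j -
        (q : K)⁻¹ * (limFrame (p ^ e) q g a * connMatrix (p ^ e) q g i a) j u := by
    intro j hij
    rw [fderiv_limFrame_of_ne ha hp h hij (hd i j hij), gaudin_mulVec_apply_of_ne q hij, mul_sub]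
  by_cases hij : i = j
  swap
  · exact hne j hij
  subst hij
  have h1 : ∑ j, fderiv K (fun x => limFrame (p ^ e) q g x j u) a (Pi.single i 1) = 0 := by
    have h2 := (HasFDerivAt.fun_sum (u := Finset.univ) fun (j : Fin (q * g + 1)) _ =>
      (analyticAt_limFrame ha hp h j u).differentiableAt.hasFDerivAt).fderiv
    rw [← _root_.sum_apply, ← h2]
    have h3 : (fun x : Fin (q * g + 1) → K => ∑ j, limFrame (p ^ e) q g x j u) =ᶠ[𝓝 a]
        fun _ => 0 := by
      filter_upwards [eventually_add_mem_unitDomain h] with x hx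
      exact sum_limRow_cofactorPoly ha hp hx.1 u
    rw [h3.fderiv_eq]; simp
  have h2 : ∑ j, ((gaudin q i a).mulVec (fun k => limFrame (p ^ e) q g a k u) j -
      (q : K)⁻¹ * (limFrame (p ^ e) q g a * connMatrix (p ^ e) q g i a) j u) = 0 := by
    rw [Finset.sum_sub_distrib, sum_gaudin_mulVec, ← Finset.mul_sum]
    simp only [Matrix.mul_apply]
    rw [Finset.sum_comm, Finset.sum_eq_zero]
    · simp
    · intro w _
      rw [← Finset.sum_mul]
      refine mul_eq_zero_of_left ?_ _
      exact sum_limRow_cofactorPoly ha hp h w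
  rw [← Finset.add_sum_erase _ _ (Finset.mem_univ i)] at h1 h2
  rw [Finset.sum_congr rfl fun j hj => hne j (Finset.ne_of_mem_erase hj).symm] at h1
  exact add_right_cancel (h1.trans h2.symm)

/-- By the Leibniz rule the Gaudin term cancels against H_i s. What remains lies in the span of the
columns, with coefficients free of the denominators z_i - z_j. -/
theorem nablaKZ_eq (ha : Admissible p e q g) (hp : ‖(p : K)‖ < 1)
    {a : Fin (q * g + 1) → K} (h : a ∈ unitDomain K (p ^ e) q g)
    (hd : ∀ i j, i ≠ j → a i ≠ a j) (i : Fin (q * g + 1))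
    {s : (Fin (q * g + 1) → K) → Fin (q * g + 1) → K}
    {c : (Fin (q * g + 1) → K) → Fin g → K} (hc : AnalyticAt K c a)
    (hs : s =ᶠ[𝓝 a] fun z => (limFrame (p ^ e) q g z).mulVec (c z)) :
    nablaKZ q i s a = (limFrame (p ^ e) q g a).mulVec (covDeriv (p ^ e) q g i c a) := by
  have h0 := hs.eq_of_nhds
  rw [nablaKZ, hs.fderiv_eq, h0]
  have hcu : ∀ u, HasFDerivAt (fun x => c x u)
      ((ContinuousLinearMap.proj (R := K) (φ := fun _ : Fin g => K) u).comp (fderiv K c a)) a :=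
    fun u => (ContinuousLinearMap.proj (R := K) (φ := fun _ : Fin g => K) u).hasFDerivAt.comp a
      hc.differentiableAt.hasFDerivAt
  have h1 := (hasFDerivAt_pi.2 fun j => HasFDerivAt.fun_sum (u := Finset.univ)
    fun (u : Fin g) _ => (analyticAt_limFrame ha hp h j u).differentiableAt.hasFDerivAt.fun_mul
      (hcu u)).fderiv
  have h2 : (fun z => (limFrame (p ^ e) q g z).mulVec (c z)) =
      fun z j => ∑ u, limFrame (p ^ e) q g z j u * c z u := rfl
  ext j
  rw [h2, h1]
  have h3 : (limFrame (p ^ e) q g a).mulVec (c a) =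
      ∑ u, c a u • fun k => limFrame (p ^ e) q g a k u := by
    ext k
    simp [Matrix.mulVec, dotProduct, mul_comm]
  rw [h3, Pi.sub_apply, Matrix.mulVec_sum, Finset.sum_apply]
  simp only [ContinuousLinearMap.pi_apply, _root_.sum_apply, _root_.add_apply, _root_.smul_apply,
    ContinuousLinearMap.comp_apply, ContinuousLinearMap.proj_apply, smul_eq_mul,
    fderiv_limFrame ha hp h hd, Matrix.mulVec_smul, Pi.smul_apply]
  simp only [covDeriv, Matrix.mulVec_sub, Matrix.mulVec_smul, Matrix.mulVec_mulVec, Pi.sub_apply,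
    Pi.smul_apply, smul_eq_mul]
  change _ = ∑ u, limFrame (p ^ e) q g a j u * fderiv K c a (Pi.single i 1) u -
    (q : K)⁻¹ * ∑ u, (limFrame (p ^ e) q g a * connMatrix (p ^ e) q g i a) j u * c a u
  rw [← Finset.sum_sub_distrib, Finset.mul_sum, ← Finset.sum_sub_distrib]
  exact Finset.sum_congr rfl fun u _ => by ring

end Invariance

/-! ### Twisted cohomology and a left inverse of the frame -/

section Rank

open Polynomial

/-- The term in r is the twisted differential for the weight F^(-1/q), up to that weight and a
factor F. Degrees below n are covered by Lagrange interpolation at the a_i; higher ones are lowered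
by subtracting multiples of twisted differentials. -/
theorem exists_reduction {K : Type*} [Field K] [CharZero K] {q g : ℕ} (hq : 1 < q)
    {a : Fin (q * g + 1) → K} (hd : ∀ i j, i ≠ j → a i ≠ a j) (f : K[X]) :
    ∃ (c : Fin (q * g + 1) → K) (r : K[X]), f = ∑ i, C (c i) * cofactorPoly a i +
      (C (-(q : K)⁻¹) * derivative (rootPoly a) * r + rootPoly a * derivative r) := by
  set T : K[X] → K[X] := fun r =>
    C (-(q : K)⁻¹) * derivative (rootPoly a) * r + rootPoly a * derivative r with hT
  let S : Submodule K K[X] :=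
    { carrier := {f | ∃ (c : Fin (q * g + 1) → K) (r : K[X]),
        f = ∑ i, C (c i) * cofactorPoly a i + T r}
      add_mem' := by
        rintro _ _ ⟨c, r, rfl⟩ ⟨c', r', rfl⟩
        refine ⟨c + c', r + r', ?_⟩
        simp only [hT, Pi.add_apply, C_add, add_mul, Finset.sum_add_distrib, derivative_add]
        ring
      zero_mem' := ⟨0, 0, by simp [hT]⟩
      smul_mem' := by
        rintro x _ ⟨c, r, rfl⟩
        refine ⟨x • c, C x * r, ?_⟩
        simp only [hT, Pi.smul_apply, smul_eq_mul, C_mul, smul_eq_C_mul, derivative_C_mul,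
          mul_add, Finset.mul_sum, mul_assoc]
        ring }
  suffices h : ∀ d : ℕ, (X ^ d : K[X]) ∈ S by
    have : f ∈ S := by
      rw [f.as_sum_range_C_mul_X_pow]
      refine S.sum_mem fun i _ => ?_
      rw [← smul_eq_C_mul]
      exact S.smul_mem _ (h i)
    exact this
  intro d
  induction d using Nat.strong_induction_on with
  | _ d ih =>
  have hlow : ∀ f : K[X], f.degree < d → f ∈ S := by
    intro f hf
    rw [f.as_sum_range_C_mul_X_pow]
    refine S.sum_mem fun i hi => ?_
    by_cases h0 : f = 0
    · subst h0; simp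
    rw [← smul_eq_C_mul]
    refine S.smul_mem _ (ih i ?_)
    have := (natDegree_lt_iff_degree_lt h0).2 hf
    have := Finset.mem_range.1 hi
    omega
  by_cases hdn : d < q * g + 1
  · have hinj : Set.InjOn a (Finset.univ : Finset (Fin (q * g + 1))) := fun i _ j _ hij => by
      by_contra hne
      exact hd i j hne hij
    have h1 := Lagrange.eq_interpolate (f := (X ^ d : K[X])) hinj (by
      rw [degree_X_pow, Finset.card_univ, Fintype.card_fin]; exact_mod_cast hdn)
    refine ⟨fun i => (X ^ d : K[X]).eval (a i) * ∏ j ∈ Finset.univ.erase i, (a i - a j)⁻¹, 0, ?_⟩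
    refine h1.trans ?_
    rw [Lagrange.interpolate_apply]
    simp only [hT, mul_zero, derivative_zero, add_zero]
    refine Finset.sum_congr rfl fun i _ => ?_
    rw [C_mul, mul_assoc]
    congr 1
    simp only [Lagrange.basis, Lagrange.basisDivisor, Finset.prod_mul_distrib, cofactorPoly,
      map_prod]
  · obtain ⟨m, rfl⟩ : ∃ m, d = m + (q * g + 1) := ⟨d - (q * g + 1), by omega⟩
    have hF : (rootPoly a).Monic := monic_prod_of_monic _ _ fun j _ => monic_X_sub_C _
    have hFd : (rootPoly a).natDegree = q * g + 1 := by
      rw [rootPoly, natDegree_prod_of_monic _ _ fun j _ => monic_X_sub_C _]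
      simp
    have hFc : (rootPoly a).coeff (q * g + 1) = 1 := by
      have := hF.coeff_natDegree
      rwa [hFd] at this
    -- The leading coefficient -n/q + (m + 1) of the twisted differential of t^(m+1); it is nonzero
    -- because q does not divide n = q g + 1.
    set κ : K := -(q : K)⁻¹ * ((q * g : ℕ) + 1) + (m + 1) with hκ
    have hq0 : (q : K) ≠ 0 := Nat.cast_ne_zero.2 (by omega)
    have hκ0 : κ ≠ 0 := by
      intro h0
      have h1 : (q : K) * κ = ((q * (m + 1) : ℕ) : K) - ((q * g + 1 : ℕ) : K) := by
        rw [hκ]; push_cast; field_simp; ring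
      rw [h0, mul_zero, eq_comm, sub_eq_zero, Nat.cast_inj] at h1
      have h2 : q ∣ q * g + 1 := ⟨m + 1, h1.symm⟩
      have h3 : q ∣ 1 := (Nat.dvd_add_right (Dvd.intro g rfl)).1 h2
      have := Nat.dvd_one.1 h3
      omega
    have hcoeff : (T (X ^ (m + 1))).coeff (m + (q * g + 1)) = κ := by
      simp only [hT, coeff_add]
      rw [mul_assoc, coeff_C_mul, derivative_X_pow, ← mul_assoc, Nat.add_sub_cancel,
        show m + (q * g + 1) = q * g + (m + 1) by ring, coeff_mul_X_pow, coeff_derivative, hFc,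
        show q * g + (m + 1) = q * g + 1 + m by ring, coeff_mul_X_pow, coeff_mul_C, hFc, hκ]
      push_cast; ring
    have hdeg : (T (X ^ (m + 1))).natDegree ≤ m + (q * g + 1) := by
      refine natDegree_add_le_of_degree_le ?_ ?_
      · refine natDegree_mul_le.trans ?_
        have h1 : (C (-(q : K)⁻¹) * derivative (rootPoly a)).natDegree ≤ q * g + 1 - 1 := by
          refine (natDegree_C_mul_le _ _).trans ?_
          exact (natDegree_derivative_le _).trans (by rw [hFd])
        rw [natDegree_X_pow]; omega
      · refine natDegree_mul_le.trans ?_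
        have h1 := natDegree_derivative_le (X ^ (m + 1) : K[X])
        rw [natDegree_X_pow] at h1
        omega
    have hTS : T (X ^ (m + 1)) ∈ S := ⟨0, X ^ (m + 1), by simp⟩
    have hrem : (X ^ (m + (q * g + 1)) - κ⁻¹ • T (X ^ (m + 1))).degree <
        ((m + (q * g + 1) : ℕ) : WithBot ℕ) := by
      rw [degree_lt_iff_coeff_zero]
      intro k hk
      rw [coeff_sub, coeff_smul, coeff_X_pow]
      rcases hk.eq_or_lt with h1 | h1
      · rw [← h1, if_pos rfl, hcoeff, smul_eq_mul, inv_mul_cancel₀ hκ0, sub_self]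
      · rw [if_neg h1.ne', coeff_eq_zero_of_natDegree_lt (hdeg.trans_lt h1), smul_zero, sub_zero]
    have := S.add_mem (hlow _ hrem) (S.smul_mem κ⁻¹ hTS)
    rwa [sub_add_cancel] at this

/-- The bound depends on r alone, hence is uniform in s when Y is a power of F. -/
theorem exists_norm_coeff_mul_le {K : Type*} [NontriviallyNormedField K] (r : K[X]) :
    ∃ B : ℝ, ∀ Y : K[X], (∀ m, ‖Y.coeff m‖ ≤ 1) → ∀ m, ‖(Y * r).coeff m‖ ≤ B := by
  induction r using Polynomial.induction_on' with
  | add r r' h h' =>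
    obtain ⟨B, hB⟩ := h
    obtain ⟨B', hB'⟩ := h'
    refine ⟨B + B', fun Y hY m => ?_⟩
    rw [mul_add, coeff_add]
    exact (norm_add_le _ _).trans (add_le_add (hB Y hY m) (hB' Y hY m))
  | monomial k c =>
    refine ⟨‖c‖, fun Y hY m => ?_⟩
    rw [← C_mul_X_pow_eq_monomial, ← mul_assoc, coeff_mul_X_pow']
    split_ifs
    · rw [coeff_mul_C, norm_mul]
      exact mul_le_of_le_one_left (norm_nonneg _) (hY _)
    · simp

variable {K : Type*} [NontriviallyNormedField K] [IsUltrametricDist K]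

theorem norm_coeff_rootPoly_pow_le {n : ℕ} {a : Fin n → K} (h : ∀ i, ‖a i‖ ≤ 1) (N m : ℕ) :
    ‖(rootPoly a ^ N).coeff m‖ ≤ 1 := by
  have h1 : rootPoly a ^ N =
      (rootPoly (fun i => (⟨a i, h i⟩ : integers K)) ^ N).map (integers K).subtype := by
    rw [Polynomial.map_pow, map_rootPoly]; rfl
  rw [h1, coeff_map]
  exact norm_integers_le _

variable {p e q g : ℕ} [Fact p.Prime] [CharZero K]

/-- Reduce t^u F and multiply by F^(N_s - 1). The exponent N_s differs from -1/q by P^s/q, so the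
twisted differential becomes an honest derivative plus a term with factor P^s; the coefficient of
the derivative also carries P^s. -/
theorem exists_norm_hwMatrix_sub_le (hq : 1 < q) (ha : Admissible p e q g)
    {a : Fin (q * g + 1) → K} (h : ∀ i, ‖a i‖ ≤ 1) (hd : ∀ i j, i ≠ j → a i ≠ a j) (u : Fin g) :
    ∃ (c : Fin (q * g + 1) → K) (B : ℝ), ∀ s, 1 ≤ s → ∀ l : Fin g,
      ‖hwMatrix (rootPoly a) (p ^ e) q g s u l -
        ∑ i, c i * row (rootPoly a) (p ^ e) q g s (cofactorPoly a i) l‖ ≤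
        ‖((p ^ e : ℕ) : K) ^ s‖ * B := by
  obtain ⟨c, r, hcr⟩ := exists_reduction hq hd (X ^ (u : ℕ) * rootPoly a)
  obtain ⟨B, hB⟩ := exists_norm_coeff_mul_le r
  obtain ⟨B', hB'⟩ := exists_norm_coeff_mul_le (derivative (rootPoly a) * r)
  refine ⟨c, B + ‖(q : K)⁻¹‖ * B', fun s hs l => ?_⟩
  obtain ⟨N, hN⟩ : ∃ N, expo (p ^ e) q s = N + 1 :=
    ⟨_, (Nat.sub_add_cancel (ha.expo_pos hs)).symm⟩
  have hq0 : (q : K) ≠ 0 := Nat.cast_ne_zero.2 ha.q_pos.ne'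
  have hN' : ((N : K) + 1) + (q : K)⁻¹ = ((p ^ e : ℕ) : K) ^ s * (q : K)⁻¹ := by
    have h1 : (q : K) * ((N : K) + 1) = ((p ^ e : ℕ) : K) ^ s - 1 := by
      have h2 := congrArg (Nat.cast (R := K)) (mul_expo ha.dvd s)
      rw [hN, Nat.cast_sub (Nat.one_le_pow _ _ (zero_lt_one.trans ha.one_lt))] at h2
      simpa using h2
    field_simp
    linear_combination h1
  set idx := ((l : ℕ) + 1) * (p ^ e) ^ s - 1 with hidx
  have hidx' : idx + 1 = ((l : ℕ) + 1) * (p ^ e) ^ s :=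
    Nat.sub_add_cancel (Nat.mul_pos (Nat.succ_pos _) (pow_pos (zero_lt_one.trans ha.one_lt) _))
  have hpoly : (C (-(q : K)⁻¹) * derivative (rootPoly a) * r + rootPoly a * derivative r) *
      rootPoly a ^ N = derivative (rootPoly a ^ (N + 1) * r) -
        C (((N : K) + 1) + (q : K)⁻¹) * (rootPoly a ^ N * (derivative (rootPoly a) * r)) := by
    rw [derivative_mul, derivative_pow, Nat.add_sub_cancel, pow_succ]
    simp only [C_add, C_neg, C_1, Nat.cast_add, Nat.cast_one]
    ring
  have herr : hwMatrix (rootPoly a) (p ^ e) q g s u l -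
      ∑ i, c i * row (rootPoly a) (p ^ e) q g s (cofactorPoly a i) l =
      ((p ^ e : ℕ) : K) ^ s * ((((l : ℕ) + 1 : ℕ) : K) * (rootPoly a ^ (N + 1) * r).coeff (idx + 1) -
        (q : K)⁻¹ * (rootPoly a ^ N * (derivative (rootPoly a) * r)).coeff idx) := by
    simp only [hwMatrix, Matrix.of_apply, row, hN, Nat.add_sub_cancel, ← hidx]
    rw [hcr, add_mul, coeff_add, Finset.sum_mul, finsetSum_coeff, hpoly, coeff_sub, coeff_C_mul,
      hN', coeff_derivative]
    have h1 : (idx : K) + 1 = (((l : ℕ) + 1 : ℕ) : K) * ((p ^ e : ℕ) : K) ^ s := by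
      rw [← Nat.cast_pow, ← Nat.cast_mul, ← hidx']; push_cast; ring
    rw [h1]
    simp only [mul_assoc, coeff_C_mul]
    ring
  rw [herr, norm_mul]
  refine mul_le_mul_of_nonneg_left ((norm_sub_le _ _).trans (add_le_add ?_ ?_)) (norm_nonneg _)
  · rw [norm_mul]
    exact (mul_le_of_le_one_left (norm_nonneg _) (IsUltrametricDist.norm_natCast_le_one K _)).trans
      (hB _ (norm_coeff_rootPoly_pow_le h _) _)
  · rw [norm_mul]
    exact mul_le_mul_of_nonneg_left (hB' _ (norm_coeff_rootPoly_pow_le h _) _) (norm_nonneg _)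

/-- At points with distinct coordinates the limit frame has a left inverse. -/
theorem exists_mul_limFrame_eq_one [CompleteSpace K] (hq : 1 < q) (ha : Admissible p e q g)
    (hp : ‖(p : K)‖ < 1) {a : Fin (q * g + 1) → K} (h : a ∈ unitDomain K (p ^ e) q g)
    (hd : ∀ i j, i ≠ j → a i ≠ a j) :
    ∃ M : Matrix (Fin g) (Fin (q * g + 1)) K, M * limFrame (p ^ e) q g a = 1 := by
  choose c B hB using exists_norm_hwMatrix_sub_le hq ha h.1 hd
  refine ⟨Matrix.of c, ?_⟩
  ext u w
  rw [Matrix.mul_apply]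
  have h1 : Tendsto (fun s => ∑ i, c u i * nrowAt (p ^ e) q g s (cofactorPoly MvPolynomial.X i) a w)
      atTop (𝓝 (∑ i, Matrix.of c u i * limFrame (p ^ e) q g a i w)) :=
    tendsto_finsetSum _ fun i _ =>
      (tendsto_nrowAt ha hp h (natDegree_cofactorPoly_X_le i) w).const_mul _
  refine tendsto_nhds_unique h1 (tendsto_iff_norm_sub_tendsto_zero.2 ?_)
  have h2 : Tendsto (fun s => ∑ _l : Fin g, ‖((p ^ e : ℕ) : K) ^ s‖ * B u) atTop (𝓝 0) := by
    have := (tendsto_zero_iff_norm_tendsto_zero.1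
      (tendsto_pow_natCast (K := K) ha.e_pos hp)).mul_const (B u)
    rw [zero_mul] at this
    simpa using tendsto_finsetSum (Finset.univ : Finset (Fin g)) fun _ _ => this
  refine squeeze_zero' (Eventually.of_forall fun _ => norm_nonneg _) ?_ h2
  filter_upwards [eventually_ge_atTop 1] with s hs
  have hu := isUnit_det_hwMatrix_of_mem ha hp h hs
  -- Integrality of A_s⁻¹ ensures that multiplying by it does not enlarge the O(P^s) error.
  have hinv : ∀ l, ‖(hwMatrix (rootPoly a) (p ^ e) q g s)⁻¹ l w‖ ≤ 1 := by
    intro l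
    have h3 := isUnit_det_toIntegers ha hp h hs
    have h4 : (hwMatrix (rootPoly a) (p ^ e) q g s)⁻¹ =
        (hwMatrix (rootPoly (toIntegers h)) (p ^ e) q g s)⁻¹.map (integers K).subtype := by
      apply Matrix.inv_eq_right_inv
      have h5 : hwMatrix (rootPoly a) (p ^ e) q g s =
        (hwMatrix (rootPoly (toIntegers h)) (p ^ e) q g s).map (integers K).subtype :=
        hwMatrix_rootPoly_map (integers K).subtype (toIntegers h) (p ^ e) q g s
      rw [h5, ← Matrix.map_mul, Matrix.mul_nonsing_inv _ h3]
      simp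
    rw [h4]
    exact norm_integers_le (K := K) ((hwMatrix (rootPoly (toIntegers h)) (p ^ e) q g s)⁻¹ l w)
  have h3 : (1 : Matrix (Fin g) (Fin g) K) u w = ∑ l, hwMatrix (rootPoly a) (p ^ e) q g s u l *
      (hwMatrix (rootPoly a) (p ^ e) q g s)⁻¹ l w := by
    rw [← Matrix.mul_apply, Matrix.mul_nonsing_inv _ hu]
  have h4 : ∑ i, c u i * nrowAt (p ^ e) q g s (cofactorPoly MvPolynomial.X i) a w =
      ∑ l, (∑ i, c u i * row (rootPoly a) (p ^ e) q g s (cofactorPoly a i) l) *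
        (hwMatrix (rootPoly a) (p ^ e) q g s)⁻¹ l w := by
    simp only [nrowAt, nrow, Matrix.vecMul, dotProduct, map_spec_cofactorPoly, Finset.mul_sum,
      Finset.sum_mul]
    rw [Finset.sum_comm]
    simp only [mul_assoc]
  rw [norm_sub_rev, h3, h4, ← Finset.sum_sub_distrib]
  refine (norm_sum_le _ _).trans (Finset.sum_le_sum fun l _ => ?_)
  rw [← sub_mul, norm_mul]
  exact (mul_le_of_le_one_right (norm_nonneg _) (hinv l)).trans (hB u s hs l)

end Rank

/-! ### From the definitions of the statement to normalized rows -/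

section Translation

theorem ord_pos_and_dvd {p q : ℕ} (hpq : p.Coprime q) (hq : 0 < q) :
    1 ≤ ord p q ∧ q ∣ p ^ ord p q - 1 := by
  have : NeZero q := ⟨hq.ne'⟩
  have h1 : 0 < ord p q := by
    rw [ord, ← ZMod.coe_unitOfCoprime p hpq, orderOf_units]
    exact orderOf_pos _
  refine ⟨h1, ?_⟩
  have h2 : ((p ^ ord p q : ℕ) : ZMod q) = ((1 : ℕ) : ZMod q) := by
    rw [Nat.cast_pow, Nat.cast_one]
    exact pow_orderOf_eq_one _
  have h3 := (ZMod.natCast_eq_natCast_iff _ _ _).1 h2.symm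
  rcases Nat.eq_zero_or_pos (p ^ ord p q) with h0 | h0
  · simp [h0]
  · exact (Nat.modEq_iff_dvd' h0).1 h3

theorem admissible_ord {p q g : ℕ} [Fact p.Prime] (hq : q.Prime) (hqp : q < p)
    (hpe : q * g + 1 < p ^ ord p q) : Admissible p (ord p q) q g := by
  have h1 : p.Coprime q := (Nat.coprime_primes Fact.out hq).2 hqp.ne'
  obtain ⟨h2, h3⟩ := ord_pos_and_dvd h1 hq.pos
  refine ⟨hq.pos, h2, h3, ?_⟩
  have := Nat.le_mul_of_pos_left g hq.pos
  omega

theorem mem_fiberL_iff {K : Type*} [NontriviallyNormedField K] {p q g : ℕ}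
    {a v : Fin (q * g + 1) → K} :
    v ∈ fiberL K p q g a ↔ ∃ c : Fin g → K, v = (frame K p q g a).mulVec c := by
  rw [fiberL, Submodule.mem_span_range_iff_exists_fun]
  refine exists_congr fun c => ?_
  have : ∑ l, c l • (fun i => frame K p q g a i l) = (frame K p q g a).mulVec c := by
    ext i
    simp [Matrix.mulVec, dotProduct, mul_comm]
  rw [this, eq_comm]

variable {K : Type*} [NontriviallyNormedField K] {p q g : ℕ} [Fact p.Prime]

theorem hasseWittAt_eq (ha : Admissible p (ord p q) q g) {s : ℕ} (hs : 1 ≤ s)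
    (a : Fin (q * g + 1) → K) :
    hasseWittAt K p q g s a = hwMatrix (rootPoly a) (p ^ ord p q) q g s := by
  rw [hasseWittAt, hasseWitt_eq (ha.expo_pos hs)
    (ha.le.trans_le (Nat.le_self_pow (by omega) _)), ← map_spec_rootPoly a, hwMatrix_map]
  rfl

theorem approxFrame_apply (ha : Admissible p (ord p q) q g) {s : ℕ} (hs : 1 ≤ s)
    (a : Fin (q * g + 1) → K) (i : Fin (q * g + 1)) (l : Fin g) :
    approxFrame K p q g s a i l =
      nrowAt (p ^ ord p q) q g s (cofactorPoly MvPolynomial.X i) a l := by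
  rw [approxFrame, hasseWittAt_eq ha hs, Matrix.mul_apply, nrowAt, nrow]
  refine Finset.sum_congr rfl fun w _ => ?_
  rw [← spec_row, hypSolAt, Matrix.map_apply, hypSol_apply (ha.expo_pos hs)]
  rfl

theorem domainKZ_eq (ha : Admissible p (ord p q) q g) :
    domainKZ K p q g = unitDomain K (p ^ ord p q) q g := by
  ext a
  rw [domainKZ, unitDomain, Set.mem_ofPred_eq, hasseWittAt_eq ha le_rfl]
  rfl

/-- The two sequences are compared only for s ≥ 1, which is enough for the limit; no convergence is
needed, so a is arbitrary. -/
theorem frame_eq (ha : Admissible p (ord p q) q g) (a : Fin (q * g + 1) → K) :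
    frame K p q g a = limFrame (p ^ ord p q) q g a := by
  ext i l
  refine congrArg lim (Filter.map_congr ?_)
  filter_upwards [eventually_ge_atTop 1] with s hs
  exact approxFrame_apply ha hs a i l

theorem finrank_fiberW (n : ℕ) : Module.finrank K (fiberW K (n + 1)) = n := by
  let φ : Module.Dual K (Fin (n + 1) → K) := ∑ i, LinearMap.proj i
  have hφ : ∀ v, φ v = ∑ i, v i := fun v => by simp [φ]
  have h0 : φ ≠ 0 := by
    intro h
    have h1 := hφ (Pi.single 0 1)
    rw [h] at h1
    simp at h1
  have h1 : fiberW K (n + 1) = LinearMap.ker φ := by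
    ext v
    rw [LinearMap.mem_ker, hφ]
    rfl
  have h2 := Module.Dual.finrank_ker_add_one_of_ne_zero h0
  rw [Module.finrank_fin_fun] at h2
  rw [h1]
  omega

theorem analyticAt_det {E : Type*} [NormedAddCommGroup E] [NormedSpace K E] {m : ℕ}
    {M : E → Matrix (Fin m) (Fin m) K} {a : E} (hM : ∀ i j, AnalyticAt K (fun x => M x i j) a) :
    AnalyticAt K (fun x => (M x).det) a := by
  simp only [Matrix.det_apply, Units.smul_def, zsmul_eq_mul]
  exact Finset.analyticAt_fun_sum _ fun σ _ => analyticAt_const.mul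
    (Finset.analyticAt_fun_prod _ fun i _ => hM _ _)

theorem analyticAt_nonsing_inv {E : Type*} [NormedAddCommGroup E] [NormedSpace K E] {m : ℕ}
    {M : E → Matrix (Fin m) (Fin m) K} {a : E} (hM : ∀ i j, AnalyticAt K (fun x => M x i j) a)
    (h : (M a).det ≠ 0) (i j : Fin m) : AnalyticAt K (fun x => (M x)⁻¹ i j) a := by
  simp only [Matrix.inv_def, Matrix.smul_apply, Matrix.adjugate_apply, Ring.inverse_eq_inv',
    smul_eq_mul]
  refine ((analyticAt_det hM).inv h).mul (analyticAt_det fun k l => ?_)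
  simp only [Matrix.updateRow_apply]
  split_ifs
  · exact analyticAt_const
  · exact hM k l

end Translation

/-! ### Sections of the subbundle -/

section Sections

variable {K : Type*} [NontriviallyNormedField K] [IsUltrametricDist K] [CompleteSpace K]
  {p q g : ℕ} [Fact p.Prime]

theorem tendstoUniformlyOn_approxFrame (ha : Admissible p (ord p q) q g) (hp : ‖(p : K)‖ < 1)
    (i : Fin (q * g + 1)) (l : Fin g) :
    TendstoUniformlyOn (fun (s : ℕ) a => approxFrame K p q g s a i l)
      (fun a => frame K p q g a i l) atTop (domainKZ K p q g) := by
  simp only [domainKZ_eq ha, frame_eq ha]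
  refine (tendstoUniformlyOn_nrowAt ha hp (natDegree_cofactorPoly_X_le i) l).congr ?_
  filter_upwards [eventually_ge_atTop 1] with s hs a _
  exact (approxFrame_apply ha hs a i l).symm

variable [CharZero K]

theorem isFrameSection_nablaKZ (ha : Admissible p (ord p q) q g) (hp : ‖(p : K)‖ < 1)
    {U : Set (Fin (q * g + 1) → K)} (hU : IsOpen U) (hUD : U ⊆ domainKZ K p q g)
    {s : (Fin (q * g + 1) → K) → Fin (q * g + 1) → K} (hs : IsFrameSection p q g U s)
    (i : Fin (q * g + 1)) : ∃ s', IsFrameSection p q g U s' ∧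
      ∀ z ∈ U ∩ domainKZo K p q g, nablaKZ q i s z = s' z := by
  obtain ⟨c, hc, hsc⟩ := hs
  rw [domainKZ_eq ha] at hUD
  refine ⟨fun z => (frame K p q g z).mulVec (covDeriv (p ^ ord p q) q g i c z),
    ⟨_, fun z hz => analyticAt_covDeriv ha hp (hUD hz) i (hc z hz), fun _ _ => rfl⟩, ?_⟩
  rintro z ⟨hz, hz'⟩
  beta_reduce
  rw [frame_eq ha]
  refine nablaKZ_eq ha hp (hUD hz) hz'.2 i (hc z hz) ?_
  filter_upwards [hU.mem_nhds hz] with x hx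
  rw [← frame_eq ha]
  exact hsc x hx

/-- Let M be a left inverse of 𝓘(a). Near a the matrix M 𝓘(z) stays invertible, and the coefficients
are forced to be (M 𝓘)⁻¹ M s, which is analytic. -/
theorem exists_analytic_coefficients (hq : 1 < q) (ha : Admissible p (ord p q) q g)
    (hp : ‖(p : K)‖ < 1) {U : Set (Fin (q * g + 1) → K)} (hU : IsOpen U)
    {s : (Fin (q * g + 1) → K) → Fin (q * g + 1) → K}
    (hs : IsFiberSection p q g U s) {a : Fin (q * g + 1) → K} (haU : a ∈ U)
    (haD : a ∈ domainKZo K p q g) : ∃ c : (Fin (q * g + 1) → K) → Fin g → K,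
      AnalyticAt K c a ∧ s =ᶠ[𝓝 a] fun z => (limFrame (p ^ ord p q) q g z).mulVec (c z) := by
  have haD' := haD.1
  rw [domainKZ_eq ha] at haD'
  obtain ⟨M, hM⟩ := exists_mul_limFrame_eq_one hq ha hp haD' haD.2
  let A : (Fin (q * g + 1) → K) → Matrix (Fin g) (Fin g) K := fun z =>
    M * limFrame (p ^ ord p q) q g z
  have hA : ∀ i j, AnalyticAt K (fun z => A z i j) a := fun i j => by
    simp only [A, Matrix.mul_apply]
    exact Finset.analyticAt_fun_sum _ fun k _ =>
      analyticAt_const.mul (analyticAt_limFrame ha hp haD' k j)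
  have hdet : (A a).det ≠ 0 := by
    simp only [A, hM, Matrix.det_one]
    exact one_ne_zero
  refine ⟨fun z => (A z)⁻¹.mulVec (M.mulVec (s z)), ?_, ?_⟩
  · exact analyticAt_mulVec (analyticAt_nonsing_inv hA hdet)
      (analyticAt_mulVec (fun _ _ => analyticAt_const) (hs.1 a haU))
  · filter_upwards [hU.mem_nhds haU,
      (analyticAt_det hA).continuousAt.eventually_ne hdet] with z hz hzd
    obtain ⟨v, hv⟩ := mem_fiberL_iff.1 (hs.2 z hz)
    rw [frame_eq ha] at hv
    have h : (A z)⁻¹.mulVec (M.mulVec (s z)) = v := by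
      have h' : M.mulVec (s z) = (A z).mulVec v := by rw [hv, Matrix.mulVec_mulVec]
      rw [h', Matrix.mulVec_mulVec, Matrix.nonsing_inv_mul _ (isUnit_iff_ne_zero.2 hzd),
        Matrix.one_mulVec]
    rw [h, hv]

theorem isFiberSection_nablaKZ (hq : 1 < q) (ha : Admissible p (ord p q) q g)
    (hp : ‖(p : K)‖ < 1) {U : Set (Fin (q * g + 1) → K)} (hU : IsOpen U)
    (hUD : U ⊆ domainKZo K p q g) {s : (Fin (q * g + 1) → K) → Fin (q * g + 1) → K}
    (hs : IsFiberSection p q g U s) (i : Fin (q * g + 1)) :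
    IsFiberSection p q g U (nablaKZ q i s) := by
  have hUD' : ∀ z ∈ U, z ∈ unitDomain K (p ^ ord p q) q g := fun z hz => by
    rw [← domainKZ_eq ha]; exact (hUD hz).1
  refine ⟨fun a haU => ?_, fun a haU => ?_⟩
  · obtain ⟨c, hc, hsc⟩ := exists_analytic_coefficients hq ha hp hU hs haU (hUD haU)
    refine (analyticAt_mulVec (fun j u => analyticAt_limFrame ha hp (hUD' a haU) j u)
      (analyticAt_covDeriv ha hp (hUD' a haU) i hc)).congr ?_
    filter_upwards [hU.mem_nhds haU, hc.eventually_analyticAt, hsc.eventuallyEq_nhds]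
      with z hz hzc hzs
    exact (nablaKZ_eq ha hp (hUD' z hz) (hUD hz).2 i hzc hzs).symm
  · obtain ⟨c, hc, hsc⟩ := exists_analytic_coefficients hq ha hp hU hs haU (hUD haU)
    rw [nablaKZ_eq ha hp (hUD' a haU) (hUD haU).2 i hc hsc, ← frame_eq ha]
    exact mem_fiberL_iff.2 ⟨_, rfl⟩

theorem finrank_fiberL (hq : 1 < q) (ha : Admissible p (ord p q) q g)
    (hp : ‖(p : K)‖ < 1) {a : Fin (q * g + 1) → K} (haD : a ∈ domainKZo K p q g) :
    Module.finrank K (fiberL K p q g a) = g := by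
  have haD' := haD.1
  rw [domainKZ_eq ha] at haD'
  obtain ⟨M, hM⟩ := exists_mul_limFrame_eq_one hq ha hp haD' haD.2
  rw [← frame_eq ha] at hM
  have hinj : Function.Injective (frame K p q g a).mulVec := by
    intro v w hvw
    have := congrArg M.mulVec hvw
    simpa [Matrix.mulVec_mulVec, hM] using this
  have hli : LinearIndependent K fun l : Fin g => fun i => frame K p q g a i l :=
    Matrix.mulVec_injective_iff.1 hinj
  rw [fiberL, finrank_span_eq_card hli, Fintype.card_fin]

theorem fiberL_le_fiberW (ha : Admissible p (ord p q) q g) (hp : ‖(p : K)‖ < 1)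
    {a : Fin (q * g + 1) → K} (haD : a ∈ domainKZ K p q g) :
    fiberL K p q g a ≤ fiberW K (q * g + 1) := by
  rw [domainKZ_eq ha] at haD
  rw [fiberL, Submodule.span_le]
  rintro _ ⟨l, rfl⟩
  simp only [frame_eq ha]
  exact sum_limRow_cofactorPoly ha hp haD l

end Sections

/-! ### The unramified extension is a complete ultrametric field -/

section Unramified

variable (p : ℕ) [Fact p.Prime] (m : ℕ)

instance : IsUltrametricDist (Qpm p m) :=
  inferInstanceAs (IsUltrametricDist (unramified p m))

instance : CharZero (Qpm p m) := inferInstanceAs (CharZero (unramified p m))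

theorem norm_natCast_lt_one_Qpm : ‖(p : Qpm p m)‖ < 1 := by
  have h1 : ‖(p : Qpm p m)‖ = ‖((p : unramified p m) : PadicAlgCl p)‖ := rfl
  have h2 : ((p : unramified p m) : PadicAlgCl p) = algebraMap ℚ_[p] (PadicAlgCl p) p := by simp
  rw [h1, h2, PadicAlgCl.norm_extends]
  exact Padic.norm_p_lt_one

/-- Finitely many algebraic elements are adjoined. For m = 0 the equation ζ^0 = 1 would be no
condition at all. -/
theorem finiteDimensional_unramified (hm : 0 < m) :
    FiniteDimensional ℚ_[p] (unramified p m) := by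
  classical
  have hpos : 0 < p ^ m - 1 := Nat.sub_pos_of_lt (Nat.one_lt_pow hm.ne' (Fact.out : p.Prime).one_lt)
  have hfin : Set.Finite {ζ : PadicAlgCl p | ζ ^ (p ^ m - 1) = 1} := by
    refine (Polynomial.nthRoots (p ^ m - 1) (1 : PadicAlgCl p)).toFinset.finite_toSet.subset ?_
    intro ζ hζ
    simpa [Polynomial.mem_nthRoots hpos] using hζ
  have := hfin.to_subtype
  exact IntermediateField.finiteDimensional_adjoin fun x _ => Algebra.IsIntegral.isIntegral x

theorem completeSpace_Qpm (hm : 0 < m) : CompleteSpace (Qpm p m) := by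
  have := finiteDimensional_unramified p m hm
  exact FiniteDimensional.complete ℚ_[p] (unramified p m)

end Unramified

end PadicKZ
end

theorem mainTheorem2 (p q g m : ℕ) [Fact p.Prime] (hq : q.Prime) (hqp : q < p)
    (hg : 0 < g) (hm : 0 < m)
    (hpe : q * g + 1 < p ^ PadicKZ.ord p q)
    (hp : (q * g + 1) + q - 2 ≤ p) :
    -- the matrices `A(Φ_s(t, a))` are invertible on the domain
    (∀ s : ℕ, 1 ≤ s → ∀ a ∈ PadicKZ.domainKZ (PadicKZ.Qpm p m) p q g,
      ‖(PadicKZ.hasseWittAt (PadicKZ.Qpm p m) p q g s a).det‖ = 1) ∧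
    -- `𝓘` is a uniform limit on the domain, and is analytic there
    (∀ i l, TendstoUniformlyOn
      (fun (s : ℕ) a => PadicKZ.approxFrame (PadicKZ.Qpm p m) p q g s a i l)
      (fun a => PadicKZ.frame (PadicKZ.Qpm p m) p q g a i l) Filter.atTop
      (PadicKZ.domainKZ (PadicKZ.Qpm p m) p q g)) ∧
    (∀ i l, AnalyticOnNhd (PadicKZ.Qpm p m)
      (fun a => PadicKZ.frame (PadicKZ.Qpm p m) p q g a i l)
      (PadicKZ.domainKZ (PadicKZ.Qpm p m) p q g)) ∧
    -- `𝓛` is a distribution in the fibers of the KZ bundle, which have dimension `q g`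
    (Module.finrank (PadicKZ.Qpm p m) (PadicKZ.fiberW (PadicKZ.Qpm p m) (q * g + 1)) = q * g ∧
      ∀ a ∈ PadicKZ.domainKZ (PadicKZ.Qpm p m) p q g,
        PadicKZ.fiberL (PadicKZ.Qpm p m) p q g a ≤
          PadicKZ.fiberW (PadicKZ.Qpm p m) (q * g + 1)) ∧
    -- invariance over the whole domain: the image of a section is, off the diagonals,
    -- the restriction of a section
    (∀ U : Set (Fin (q * g + 1) → PadicKZ.Qpm p m), IsOpen U →
      U ⊆ PadicKZ.domainKZ (PadicKZ.Qpm p m) p q g →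
      ∀ s, PadicKZ.IsFrameSection p q g U s → ∀ i,
        ∃ s', PadicKZ.IsFrameSection p q g U s' ∧
          ∀ z ∈ U ∩ PadicKZ.domainKZo (PadicKZ.Qpm p m) p q g,
            PadicKZ.nablaKZ q i s z = s' z) ∧
    -- invariance off the diagonals, for sections in the fiberwise sense
    (∀ U : Set (Fin (q * g + 1) → PadicKZ.Qpm p m), IsOpen U →
      U ⊆ PadicKZ.domainKZo (PadicKZ.Qpm p m) p q g →
      ∀ s, PadicKZ.IsFiberSection p q g U s → ∀ i,
        PadicKZ.IsFiberSection p q g U (PadicKZ.nablaKZ q i s)) ∧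
    -- the rank of the invariant subbundle
    (PadicKZ.dPhi p q g + PadicKZ.dM p q g < p ^ m →
      ∀ a ∈ PadicKZ.domainKZo (PadicKZ.Qpm p m) p q g,
        Module.finrank (PadicKZ.Qpm p m) (PadicKZ.fiberL (PadicKZ.Qpm p m) p q g a) = g) := by
  have ha := PadicKZ.admissible_ord hq hqp hpe
  have hn := PadicKZ.norm_natCast_lt_one_Qpm p m
  have := PadicKZ.completeSpace_Qpm p m hm
  refine ⟨fun s hs a haD => ?_, PadicKZ.tendstoUniformlyOn_approxFrame ha hn,
    fun i l a haD => ?_, ⟨PadicKZ.finrank_fiberW _, fun a haD =>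
      PadicKZ.fiberL_le_fiberW ha hn haD⟩,
    fun U hU hUD s hs i => PadicKZ.isFrameSection_nablaKZ ha hn hU hUD hs i,
    fun U hU hUD s hs i => PadicKZ.isFiberSection_nablaKZ hq.one_lt ha hn hU hUD hs i,
    fun _ a haD => PadicKZ.finrank_fiberL hq.one_lt ha hn haD⟩
  · rw [PadicKZ.domainKZ_eq ha] at haD
    rw [PadicKZ.hasseWittAt_eq ha hs]
    exact PadicKZ.norm_det_hwMatrix ha hn haD hs
  · rw [PadicKZ.domainKZ_eq ha] at haD
    simp only [PadicKZ.frame_eq ha]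
    exact PadicKZ.analyticAt_limFrame ha hn haD i l
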